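/- **Cayley maps.** Let $G$ be a finite group and $\Omega\subseteq G$ a generating set with $e\notin\Omega$ and $\Omega^{-1}=\Omega$. Let $\mathrm{Cay}(G,\Omega)$ be the Cayley graph, with vertex set $G$ and arc set $D=G\times\Omega$, where $(\eta,\omega)$ is the arc from $\eta$ to $\eta\omega$. A cyclic permutation $\rho$ of $\Omega$ defines the Cayley map $\mathcal{CM}(G,\Omega,\rho)$, and induces the permutation $\tilde\rho(\eta,\omega)=(\eta,\rho(\omega))$ of $D$. An isomorphism $\mathcal{CM}(G,\Omega,\rho)\to\mathcal{CM}(G',\Omega',\rho')$ is a graph isomorphism $\phi:\mathrm{Cay}(G,\Omega)\to\mathrm{Cay}(G',\Omega')$ whose induced map on arcs satisfies $\phi\circ\tilde\rho=\tilde\rho'\circ\phi$. A regular balanced Cayley map (RBCM) is a Cayley map such that for any two arcs some automorphism of the map sends one to the other, and such that $\rho(\omega^{-1})=\rho(\omega)^{-1}$ for all $\omega\in\Omega$. It is $2n$-valent of type I if $|\Omega|=2n$ and one can write $\Omega=\{\omega_1^{\pm1},\dots,\omega_n^{\pm1}\}$ with $\rho(\omega_i^{\pm1})=\omega_{i+1}^{\pm1}$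 for $1\le i<n$ and $\rho(\omega_n^{\pm1})=\omega_1^{\mp1}$. **Polynomials.** Let $p$ be an odd prime, $n$ a positive integer coprime to $p$, and $k\ge 1$. For each $d$ with $d\mid 2n$ and $d\nmid n$, choose a set $\Xi(p,d)$ of representatives of the cosets of $\langle p\rangle\le(\mathbb{Z}/d)^\times$ and a primitive $d$-th root of unity $\eta_d\in\overline{\mathbb{F}_p}$, and let $o(p,d)$ be the order of $p$ in $(\mathbb{Z}/d)^\times$. Put $$\Lambda(p,n)=\{(d,\ell): d\mid 2n,\ d\nmid n,\ \ell\in\Xi(p,d)\}.$$ For $\lambda=(d,\ell)\in\Lambda(p,n)$ let $q_\lambda=\prod_{j=0}^{o(p,d)-1}\bigl(x-\eta_d^{\ell p^j}\bigr)\in\mathbb{F}_p[x]$, and let $q_\lambda^{(k)}\in\mathbb{Z}_{p^k}[x]$ (where $\mathbb{Z}_N=\mathbb{Z}/N\mathbb{Z}$) be the unique monic irreducible factor of $x^{2n}-1$ whose reduction modulo $p$ is $q_\lambda$. **Theorem.** With these choices fixed, let $\mathcal M$ be a $2n$-valent type I RBCM on a finite abelian $p$-group of exponent $p^k$. Then there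 is a unique function $J:\Lambda(p,n)\to\{0,1,\dots,k\}$ with $k\in\operatorname{Im}J$ such that $\mathcal M$ is isomorphic to the Cayley map $\mathcal{CM}(G_J,\Omega_J,\rho_J)$, where - $G_J=\prod_{\lambda\in\Lambda(p,n)}\mathbb{Z}_{p^k}[x]/(q_\lambda^{(k)},p^{J(\lambda)})$, as an additive group; - $\Omega_J=\{\pm\omega_{J,i}:1\le i\le n\}$, where $\omega_{J,i}$ is the image of $x^{i-1}$ in $G_J$; - $\rho_J$ is the permutation of $\Omega_J$ with $\rho_J(\pm\omega_{J,i})=\pm\omega_{J,i+1}$ for $1\le i<n$ and $\rho_J(\pm\omega_{J,n})=\mp\omega_{J,1}$. -/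

import Mathlib

open Polynomial

/-! Groups are written additively. -/

/-- A Cayley map on a group `G`: a generating set `Ω`, closed under inverses and without the
neutral element, together with a cyclic permutation `ρ` of `Ω`. -/
structure CayleyMap (G : Type*) [AddGroup G] where
  Ω : Set G
  zero_notMem : (0 : G) ∉ Ω
  neg_mem : ∀ ω ∈ Ω, -ω ∈ Ω
  closure_eq_top : AddSubgroup.closure Ω = ⊤
  ρ : Equiv.Perm Ω
  cyclic : ρ.IsCycleOn Set.univ

namespace CayleyMap

variable {G G' : Type*} [AddGroup G] [AddGroup G']

/-- The underlying Cayley graph `Cay(G, Ω)`. -/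
def graph (M : CayleyMap G) : SimpleGraph G := SimpleGraph.addCayley M.Ω

/-- In `Cay(G, Ω)` the neighbours of `a` are the `a + ω` with `ω ∈ Ω`. -/
theorem graph_adj (M : CayleyMap G) (a b : G) : M.graph.Adj a b ↔ -a + b ∈ M.Ω := by
  unfold graph
  rw [SimpleGraph.addCayley_adj']
  constructor
  · rintro ⟨_, g, hg, h | h⟩
    · rw [← h, neg_add_cancel_left]; exact hg
    · rw [h, neg_add_rev, add_assoc, neg_add_cancel, add_zero]; exact M.neg_mem _ hg
  · intro h
    refine ⟨?_, -a + b, h, Or.inl (add_neg_cancel_left a b)⟩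
    rintro rfl
    exact M.zero_notMem (by rwa [neg_add_cancel] at h)

/-- The arc set `G × Ω`; `(η, ω)` is the arc from `η` to `η + ω`. -/
abbrev Arc (M : CayleyMap G) : Type _ := G × M.Ω

/-- The permutation of the arcs induced by `ρ`. -/
def arcRot (M : CayleyMap G) (a : M.Arc) : M.Arc := (a.1, M.ρ a.2)

/-- The function on arcs induced by an isomorphism of the underlying graphs: the arc from `η`
to `η + ω` goes to the arc from `φ η` to `φ (η + ω)`. -/
def arcMap {M : CayleyMap G} {M' : CayleyMap G'} (φ : M.graph ≃g M'.graph) (a : M.Arc) :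
    M'.Arc :=
  (φ a.1, ⟨-φ a.1 + φ (a.1 + a.2.1), by
    rw [← M'.graph_adj, φ.map_adj_iff, M.graph_adj, neg_add_cancel_left]
    exact a.2.2⟩)

/-- A graph isomorphism is an isomorphism of Cayley maps if it commutes with the rotations. -/
def IsIso {M : CayleyMap G} {M' : CayleyMap G'} (φ : M.graph ≃g M'.graph) : Prop :=
  arcMap φ ∘ M.arcRot = M'.arcRot ∘ arcMap φ

/-- The two Cayley maps are isomorphic. -/
def Isomorphic (M : CayleyMap G) (M' : CayleyMap G') : Prop :=
  ∃ φ : M.graph ≃g M'.graph, IsIso φ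

/-- Regularity: for any two arcs some automorphism sends one to the other (it is then unique,
since the graph is connected). -/
def IsRegular (M : CayleyMap G) : Prop :=
  ∀ a b : M.Arc, ∃ φ : M.graph ≃g M.graph, IsIso φ ∧ arcMap φ a = b

/-- Balancedness: `ρ (ω⁻¹) = (ρ ω)⁻¹`. -/
def IsBalanced (M : CayleyMap G) : Prop :=
  ∀ ω : M.Ω, (M.ρ ⟨-ω.1, M.neg_mem _ ω.2⟩ : G) = -(M.ρ ω : G)

/-- A regular balanced Cayley map. -/
def IsRBCM (M : CayleyMap G) : Prop := M.IsRegular ∧ M.IsBalanced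

/-- `ρ a = b`; in particular `a` lies in `Ω`. -/
def Rotates (M : CayleyMap G) (a b : G) : Prop := ∃ h : a ∈ M.Ω, (M.ρ ⟨a, h⟩ : G) = b

/-- `Ω = {± w i : 1 ≤ i ≤ n}`, `ρ (± w i) = ± w (i + 1)` for `1 ≤ i < n` and
`ρ (± w n) = ∓ w 1`. -/
def HasSignedCycle (M : CayleyMap G) (n : ℕ) (w : ℕ → G) : Prop :=
  M.Ω = {g | ∃ i, 1 ≤ i ∧ i ≤ n ∧ (g = w i ∨ g = -w i)} ∧
  (∀ i, 1 ≤ i → i < n → M.Rotates (w i) (w (i + 1)) ∧ M.Rotates (-w i) (-w (i + 1))) ∧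
  M.Rotates (w n) (-w 1) ∧ M.Rotates (-w n) (w 1)

/-- `2n`-valent of type I. -/
def IsTypeI (M : CayleyMap G) (n : ℕ) : Prop :=
  M.Ω.ncard = 2 * n ∧ ∃ w : ℕ → G, M.HasSignedCycle n w

end CayleyMap

/-- `S` is a set of representatives of the cosets of the subgroup `⟨p⟩` of `(ℤ/d)ˣ`
(for `p` coprime to `d`). -/
def IsCosetReps (p d : ℕ) (S : Set (ZMod d)ˣ) : Prop :=
  ∀ u : (ZMod d)ˣ, ∃! l : (ZMod d)ˣ, l ∈ S ∧ ∃ j : ℕ, (u : ZMod d) = (l : ZMod d) * (p : ZMod d) ^ j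

/-- The index set `Λ(p, n)` for odd `p`: pairs `(d, ℓ)` with `d ∣ 2n`, `d ∤ n` and `ℓ` in the
chosen set `Ξ d` of coset representatives. -/
abbrev LambdaIdx (n : ℕ) (Ξ : (d : ℕ) → Set (ZMod d)ˣ) : Type :=
  {l : Σ d : ℕ, (ZMod d)ˣ // l.1 ∣ 2 * n ∧ ¬ l.1 ∣ n ∧ l.2 ∈ Ξ l.1}

section
variable (p : ℕ) [Fact p.Prime]

/-- `q_{d,ℓ} = ∏_{0 ≤ j < o(p,d)} (x - η_d ^ (ℓ p ^ j))`, where `o(p,d)` is the order of `p`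
modulo `d`. It has coefficients in `ℤ/p`; here it is seen over the algebraic closure. -/
noncomputable def qBar (η : ℕ → AlgebraicClosure (ZMod p)) (l : Σ d : ℕ, (ZMod d)ˣ) :
    (AlgebraicClosure (ZMod p))[X] :=
  ∏ j ∈ Finset.range (orderOf (p : ZMod l.1)),
    (X - C (η l.1 ^ ((l.2 : ZMod l.1).val * p ^ j)))

/-- The reduction `ℤ/p^k → ℤ/p`, followed by the inclusion into the algebraic closure. -/
noncomputable def redHom (k : ℕ) (hk : k ≠ 0) : ZMod (p ^ k) →+* AlgebraicClosure (ZMod p) :=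
  (algebraMap (ZMod p) (AlgebraicClosure (ZMod p))).comp
    (ZMod.castHom (dvd_pow_self p hk) (ZMod p))

/-- `Q` is a monic irreducible factor of `x^{2n} - 1` over `ℤ/p^k` whose reduction modulo `p`
is `q_{d,ℓ}`. -/
def IsQLift (n k : ℕ) (hk : k ≠ 0) (η : ℕ → AlgebraicClosure (ZMod p))
    (l : Σ d : ℕ, (ZMod d)ˣ) (Q : (ZMod (p ^ k))[X]) : Prop :=
  Q.Monic ∧ Irreducible Q ∧ Q ∣ X ^ (2 * n) - 1 ∧ Q.map (redHom p k hk) = qBar p η l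

/-- `q^{(k)}_λ`: the monic irreducible factor of `x^{2n} - 1` over `ℤ/p^k` lifting `q_λ`. -/
noncomputable def qLift (n k : ℕ) (hk : k ≠ 0) (η : ℕ → AlgebraicClosure (ZMod p))
    (l : Σ d : ℕ, (ZMod d)ˣ) : (ZMod (p ^ k))[X] :=
  Classical.epsilon (IsQLift p n k hk η l)

/-- The ideal `(q^{(k)}_λ, p^u)` of `ℤ/p^k[x]`. -/
noncomputable def qIdeal (n k : ℕ) (hk : k ≠ 0) (η : ℕ → AlgebraicClosure (ZMod p))
    (l : Σ d : ℕ, (ZMod d)ˣ) (u : ℕ) : Ideal (ZMod (p ^ k))[X] :=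
  Ideal.span {qLift p n k hk η l, (p : (ZMod (p ^ k))[X]) ^ u}

/-- `G_J = ∏_{λ ∈ Λ(p,n)} ℤ/p^k[x] / (q^{(k)}_λ, p^{J(λ)})`. -/
abbrev GJ (n k : ℕ) (hk : k ≠ 0) (η : ℕ → AlgebraicClosure (ZMod p))
    (Ξ : (d : ℕ) → Set (ZMod d)ˣ) (J : LambdaIdx n Ξ → Fin (k + 1)) : Type :=
  ∀ l : LambdaIdx n Ξ, (ZMod (p ^ k))[X] ⧸ qIdeal p n k hk η l.1 (J l)

/-- `ω_{J,i}`: the image of `x^{i-1}` in `G_J` (used for `i ≥ 1` only). -/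
noncomputable def omegaJ (n k : ℕ) (hk : k ≠ 0) (η : ℕ → AlgebraicClosure (ZMod p))
    (Ξ : (d : ℕ) → Set (ZMod d)ˣ) (J : LambdaIdx n Ξ → Fin (k + 1)) (i : ℕ) :
    GJ p n k hk η Ξ J :=
  fun l => Ideal.Quotient.mk (qIdeal p n k hk η l.1 (J l)) (X ^ (i - 1))

end

/-! In a map of type I, inversion on `Ω` is the power `ρ ^ n`. An isomorphism commutes with the
rotations, hence its local maps on `Ω` commute with inversion. Walking an arc back and forth then
shows that the local map is the same at every vertex, so isomorphisms are affine
(`IsIso.exists_addEquiv`). Regularity therefore extends `ρ` to an endomorphism `α` of `G`.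

With `x` acting as `α`, the group `G` is a cyclic module over `ℤ/p^k[x]`, generated by `w 1` and
killed by `x ^ n + 1`. The map is thus encoded by the ideal `annVec α (w 1)`, which contains `x ^ n
+ 1`. As `p` is prime to `2n`, this polynomial is separable modulo `p`. Its roots there are the
roots of unity of order `d ∣ 2n`, `d ∤ n`, and their Frobenius orbits are indexed by `Λ(p, n)`. By
Hensel's lemma `x ^ n + 1` is the product of the `qLift`s (`prod_qLift`). Each `(q_λ, p)` is maximal
and `p` is nilpotent, so the ideals containing `q_λ` are the `(q_λ, p ^ u)`. Comaximality makes the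
annihilator an intersection of such ideals, with exponents `J`, and the Chinese remainder theorem
identifies `G` with `G_J`.

For uniqueness, an isomorphism onto a map on `G_J` is affine and sends `w 1` to a unit, so it
determines the annihilator, and the annihilator determines `J`. -/

namespace CayleyMap

/-! ### Rigidity of isomorphisms, and transport of structure. -/

variable {G G' : Type*} [AddGroup G] [AddGroup G']

theorem exists_iterate_eq [Finite G] (M : CayleyMap G) (x y : M.Ω) : ∃ j : ℕ, M.ρ^[j] x = y := by
  have := Fintype.ofFinite M.Ω
  obtain ⟨j, hj⟩ := (M.cyclic.2 (Set.mem_univ x) (Set.mem_univ y)).exists_nat_pow_eq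
  exact ⟨j, by rw [← hj, Equiv.Perm.iterate_eq_pow]⟩

theorem HasSignedCycle.iterate_first {M : CayleyMap G} {n : ℕ} {w : ℕ → G}
    (h : M.HasSignedCycle n w) (h1 : w 1 ∈ M.Ω) :
    ∀ j, j < n → ((M.ρ^[j] ⟨w 1, h1⟩ : M.Ω) : G) = w (j + 1)
  | 0, _ => rfl
  | j + 1, hj => by
    have ih := h.iterate_first h1 j (by omega)
    obtain ⟨hm, hr⟩ := (h.2.1 (j + 1) (by omega) hj).1
    rw [Function.iterate_succ_apply', ← hr]
    congr 2
    exact Subtype.ext ih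

theorem HasSignedCycle.iterate_neg_first {M : CayleyMap G} {n : ℕ} {w : ℕ → G}
    (h : M.HasSignedCycle n w) (h1 : -w 1 ∈ M.Ω) :
    ∀ j, j < n → ((M.ρ^[j] ⟨-w 1, h1⟩ : M.Ω) : G) = -w (j + 1)
  | 0, _ => rfl
  | j + 1, hj => by
    have ih := h.iterate_neg_first h1 j (by omega)
    obtain ⟨hm, hr⟩ := (h.2.1 (j + 1) (by omega) hj).2
    rw [Function.iterate_succ_apply', ← hr]
    congr 2
    exact Subtype.ext ih

theorem HasSignedCycle.mem {M : CayleyMap G} {n : ℕ} {w : ℕ → G}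
    (h : M.HasSignedCycle n w) {i : ℕ} (h1 : 1 ≤ i) (hi : i ≤ n) : w i ∈ M.Ω := by
  rw [h.1]
  exact ⟨i, h1, hi, Or.inl rfl⟩

/-- Going `n` steps along the cycle leads from `w 1` to `-w 1` and from there back to `w 1`. Every
element of `Ω` is an iterate of one of these two, and iterates commute. -/
theorem HasSignedCycle.iterate_eq_neg {M : CayleyMap G} {n : ℕ} {w : ℕ → G}
    (h : M.HasSignedCycle n w) (x : M.Ω) : ((M.ρ^[n] x : M.Ω) : G) = -x := by
  obtain ⟨x, hx⟩ := x
  obtain ⟨i, h1, hi, hxi⟩ := (Set.ext_iff.1 h.1 x).1 hx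
  obtain ⟨n, rfl⟩ : ∃ m, n = m + 1 := ⟨n - 1, by omega⟩
  obtain ⟨i, rfl⟩ : ∃ m, i = m + 1 := ⟨i - 1, by omega⟩
  have hw := h.mem le_rfl (by omega)
  have hw' := M.neg_mem _ hw
  obtain ⟨hp, hpr⟩ := h.2.2.1
  obtain ⟨hq, hqr⟩ := h.2.2.2
  have e1 : M.ρ^[n + 1] ⟨w 1, hw⟩ = ⟨-w 1, hw'⟩ := by
    apply Subtype.ext
    rw [Function.iterate_succ_apply']
    refine Eq.trans ?_ hpr
    congr 2
    exact Subtype.ext (h.iterate_first hw n (by omega))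
  have e2 : M.ρ^[n + 1] ⟨-w 1, hw'⟩ = ⟨w 1, hw⟩ := by
    apply Subtype.ext
    rw [Function.iterate_succ_apply']
    refine Eq.trans ?_ hqr
    congr 2
    exact Subtype.ext (h.iterate_neg_first hw' n (by omega))
  rcases hxi with rfl | rfl
  · have : (⟨w (i + 1), hx⟩ : M.Ω) = M.ρ^[i] ⟨w 1, hw⟩ :=
      Subtype.ext (h.iterate_first hw i (by omega)).symm
    rw [this, ← Function.iterate_add_apply, add_comm, Function.iterate_add_apply, e1,
      h.iterate_neg_first hw' i (by omega), h.iterate_first hw i (by omega)]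
  · have : (⟨-w (i + 1), hx⟩ : M.Ω) = M.ρ^[i] ⟨-w 1, hw'⟩ :=
      Subtype.ext (h.iterate_neg_first hw' i (by omega)).symm
    rw [this, ← Function.iterate_add_apply, add_comm, Function.iterate_add_apply, e2,
      h.iterate_neg_first hw' i (by omega), h.iterate_first hw i (by omega), neg_neg]

theorem HasSignedCycle.congr {M : CayleyMap G} {n : ℕ} {w w' : ℕ → G}
    (h : M.HasSignedCycle n w) (hn : 1 ≤ n) (hw : ∀ i, 1 ≤ i → i ≤ n → w i = w' i) :
    M.HasSignedCycle n w' := by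
  obtain ⟨hΩ, hi, hl, hl'⟩ := h
  refine ⟨?_, fun i h1 h2 => ?_, ?_, ?_⟩
  · rw [hΩ]
    ext g
    refine exists_congr fun i => and_congr_right fun h1 => and_congr_right fun h2 => ?_
    rw [hw i h1 h2]
  · rw [← hw i h1 h2.le, ← hw (i + 1) (by omega) h2]
    exact hi i h1 h2
  · rwa [← hw n hn le_rfl, ← hw 1 le_rfl hn]
  · rwa [← hw n hn le_rfl, ← hw 1 le_rfl hn]

/-- An isomorphism of Cayley maps in which inversion is the same power of the rotation is affine. -/
theorem IsIso.exists_addEquiv [Finite G] {M : CayleyMap G} {M' : CayleyMap G'} {n : ℕ}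
    (hM : ∀ x, ((M.ρ^[n] x : M.Ω) : G) = -x) (hM' : ∀ x, ((M'.ρ^[n] x : M'.Ω) : G') = -x)
    {φ : M.graph ≃g M'.graph} (hφ : IsIso φ) :
    ∃ g : G ≃+ G', (∀ a, g a = -φ 0 + φ a) ∧
      ∀ x : M.Ω, ∃ h : g x ∈ M'.Ω, g (M.ρ x) = M'.ρ ⟨g x, h⟩ := by
  set F : G → M.Ω → M'.Ω := fun a x => (arcMap φ (a, x)).2 with hF
  have hFv : ∀ a x, (F a x : G') = -φ a + φ (a + x) := fun a x => rfl
  have hFρ : ∀ a, Function.Semiconj (F a) M.ρ M'.ρ := fun a x =>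
    congrArg Prod.snd (congrFun hφ (a, x))
  have hFn : ∀ a (x : M.Ω), (F a ⟨-x, M.neg_mem _ x.2⟩ : G') = -F a x := by
    intro a x
    rw [← hM', ← (hFρ a).iterate_right n x]
    congr 2
    exact Subtype.ext (hM x).symm
  -- The arc labelled `-x` at `a + x` reverses the arc labelled `x` at `a`, so the two local maps
  -- agree at `-x`. Both commute with the transitive rotations, so they agree everywhere.
  have hstep : ∀ a (x : M.Ω), F (a + x) = F a := by
    intro a x
    have h0 : F (a + x) ⟨-x, M.neg_mem _ x.2⟩ = F a ⟨-x, M.neg_mem _ x.2⟩ := by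
      apply Subtype.ext
      rw [hFn a x, hFv, hFv]
      simp
    funext y
    obtain ⟨j, rfl⟩ := M.exists_iterate_eq ⟨-x, M.neg_mem _ x.2⟩ y
    rw [(hFρ _).iterate_right j, (hFρ a).iterate_right j, h0]
  have hshift : ∀ b a, F (a + b) = F a := by
    intro b
    have hb : b ∈ AddSubgroup.closure M.Ω := by rw [M.closure_eq_top]; trivial
    induction hb using AddSubgroup.closure_induction with
    | mem x hx => exact fun a => hstep a ⟨x, hx⟩
    | zero => intro a; rw [add_zero]
    | add x y _ _ h1 h2 => intro a; rw [← add_assoc, h2, h1]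
    | neg x _ h1 => intro a; rw [← h1 (a + -x), neg_add_cancel_right]
  have hadd : ∀ b a, -φ 0 + φ (a + b) = (-φ 0 + φ a) + (-φ 0 + φ b) := by
    intro b
    have hb : b ∈ AddSubgroup.closure M.Ω := by rw [M.closure_eq_top]; trivial
    have key : ∀ a, -φ a + φ (a + b) = -φ 0 + φ b := by
      induction hb using AddSubgroup.closure_induction with
      | mem x hx =>
        intro a
        have h1 := hFv a ⟨x, hx⟩
        have h2 := hFv 0 ⟨x, hx⟩
        have h3 := hshift a 0
        rw [zero_add] at h3 h2
        rw [← h1, ← h2, h3]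
      | zero => intro a; simp
      | add x y _ _ h1 h2 =>
        intro a
        have e1 : -φ a + φ (a + (x + y)) =
            (-φ a + φ (a + x)) + (-φ (a + x) + φ (a + x + y)) := by
          rw [add_assoc, add_neg_cancel_left, add_assoc]
        rw [e1, h1, h2, ← h2 x, add_assoc, add_neg_cancel_left]
      | neg x _ h1 =>
        intro a
        have e1 := h1 (a + -x)
        have e2 := h1 (-x)
        rw [neg_add_cancel_right] at e1
        rw [neg_add_cancel] at e2
        rw [← neg_inj, neg_add_rev, neg_add_rev, neg_neg, neg_neg, e1, e2]
    intro a
    rw [← key a, add_assoc, add_neg_cancel_left]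
  let g : G ≃+ G' := AddEquiv.mk' (φ.toEquiv.trans (Equiv.addLeft (-φ 0)))
    (fun a b => hadd b a)
  have hg : ∀ a, g a = -φ 0 + φ a := fun a => rfl
  refine ⟨g, hg, fun x => ?_⟩
  have hgF : ∀ x : M.Ω, g x = F 0 x := by
    intro x
    rw [hg, hFv, zero_add]
  refine ⟨by rw [hgF]; exact (F 0 x).2, ?_⟩
  rw [hgF, hFρ 0 x]
  congr 2
  exact Subtype.ext (hgF x).symm

/-- In a regular map whose inversion is a power of the rotation, the rotation extends to an
endomorphism of the group. -/
theorem IsRegular.exists_addMonoidHom [Finite G] {M : CayleyMap G} {n : ℕ} (hreg : M.IsRegular)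
    (hM : ∀ x, ((M.ρ^[n] x : M.Ω) : G) = -x) :
    ∃ α : G →+ G, ∀ x : M.Ω, α x = M.ρ x := by
  rcases isEmpty_or_nonempty M.Ω with hE | ⟨⟨x0⟩⟩
  · exact ⟨0, fun x => hE.elim x⟩
  -- This automorphism fixes the vertex `0`, so its linear part is itself. It agrees with `ρ` at
  -- `x0` and commutes with `ρ`, hence agrees with `ρ` on the whole cycle.
  obtain ⟨φ, hφ, h0⟩ := hreg (0, x0) (0, M.ρ x0)
  obtain ⟨g, hg, hgρ⟩ := hφ.exists_addEquiv hM hM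
  have hφ0 : φ 0 = 0 := congrArg Prod.fst h0
  have h2 : g x0 = M.ρ x0 := by
    have := congrArg (fun a : M.Arc => (a.2 : G)) h0
    simp only [arcMap, zero_add] at this
    rw [hg, this]
  refine ⟨g, fun x => ?_⟩
  obtain ⟨j, rfl⟩ := M.exists_iterate_eq x0 x
  induction j with
  | zero => exact h2
  | succ j ih =>
    rw [Function.iterate_succ_apply']
    obtain ⟨h, hr⟩ := hgρ (M.ρ^[j] x0)
    refine hr.trans ?_
    congr 2
    exact Subtype.ext ih

/-- Transport of a Cayley map along a group isomorphism. -/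
def transport (M : CayleyMap G) (e : G ≃+ G') : CayleyMap G' where
  Ω := e.toEquiv '' M.Ω
  zero_notMem := by
    rintro ⟨x, hx, h⟩
    have : x = 0 := e.map_eq_zero_iff.1 h
    exact M.zero_notMem (this ▸ hx)
  neg_mem := by
    rintro _ ⟨x, hx, rfl⟩
    exact ⟨-x, M.neg_mem x hx, map_neg e x⟩
  closure_eq_top := by
    have h := AddMonoidHom.map_closure (e : G →+ G') M.Ω
    rw [M.closure_eq_top, ← AddMonoidHom.range_eq_map,
      AddMonoidHom.range_eq_top.2 e.surjective] at h
    exact h.symm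
  ρ := (e.toEquiv.image M.Ω).permCongrHom M.ρ
  cyclic := by
    refine ⟨⟨fun _ _ => trivial, Equiv.injective _ |>.injOn, fun x _ => ?_⟩, fun x _ y _ => ?_⟩
    · obtain ⟨y, hy⟩ := ((e.toEquiv.image M.Ω).permCongrHom M.ρ).surjective x
      exact ⟨y, trivial, hy⟩
    · obtain ⟨i, hi⟩ := M.cyclic.2 (Set.mem_univ ((e.toEquiv.image M.Ω).symm x))
        (Set.mem_univ ((e.toEquiv.image M.Ω).symm y))
      refine ⟨i, ?_⟩
      rw [← map_zpow]
      change (e.toEquiv.image M.Ω) ((M.ρ ^ i) ((e.toEquiv.image M.Ω).symm x)) = y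
      rw [hi, Equiv.apply_symm_apply]

theorem transport_ρ (M : CayleyMap G) (e : G ≃+ G') (x : G) (hx : x ∈ M.Ω)
    (hx' : e x ∈ (M.transport e).Ω) :
    (((M.transport e).ρ ⟨e x, hx'⟩ : (M.transport e).Ω) : G') = e (M.ρ ⟨x, hx⟩) := by
  have h : (⟨e x, hx'⟩ : (M.transport e).Ω) = e.toEquiv.image M.Ω ⟨x, hx⟩ := rfl
  rw [h]
  change ((e.toEquiv.image M.Ω) (M.ρ ((e.toEquiv.image M.Ω).symm
    (e.toEquiv.image M.Ω ⟨x, hx⟩))) : G') = _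
  rw [Equiv.symm_apply_apply]
  rfl

theorem Rotates.transport {M : CayleyMap G} {a b : G} (h : M.Rotates a b) (e : G ≃+ G') :
    (M.transport e).Rotates (e a) (e b) := by
  obtain ⟨ha, hb⟩ := h
  exact ⟨⟨a, ha, rfl⟩, (transport_ρ M e a ha _).trans (congrArg e hb)⟩

theorem HasSignedCycle.transport {M : CayleyMap G} {n : ℕ} {w : ℕ → G}
    (h : M.HasSignedCycle n w) (e : G ≃+ G') :
    (M.transport e).HasSignedCycle n (fun i => e (w i)) := by
  obtain ⟨hΩ, hi, hl, hl'⟩ := h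
  refine ⟨?_, fun i h1 h2 => ⟨(hi i h1 h2).1.transport e, ?_⟩, ?_, ?_⟩
  · change e '' M.Ω = _
    rw [hΩ]
    ext g
    constructor
    · rintro ⟨x, ⟨i, h1, h2, rfl | rfl⟩, rfl⟩
      · exact ⟨i, h1, h2, Or.inl rfl⟩
      · exact ⟨i, h1, h2, Or.inr (map_neg e _)⟩
    · rintro ⟨i, h1, h2, rfl | rfl⟩
      · exact ⟨_, ⟨i, h1, h2, Or.inl rfl⟩, rfl⟩
      · exact ⟨_, ⟨i, h1, h2, Or.inr rfl⟩, map_neg e _⟩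
  · simpa using (hi i h1 h2).2.transport e
  · simpa using hl.transport e
  · simpa using hl'.transport e

theorem isomorphic_transport (M : CayleyMap G) (e : G ≃+ G') : M.Isomorphic (M.transport e) := by
  refine ⟨⟨e.toEquiv, fun {a b} => ?_⟩, ?_⟩
  · rw [graph_adj, graph_adj]
    change -e a + e b ∈ e '' M.Ω ↔ _
    rw [← map_neg, ← map_add]
    exact e.injective.mem_set_image
  · funext ⟨a, x, hx⟩
    refine Prod.ext rfl (Subtype.ext ?_)
    have hx' : e x ∈ (M.transport e).Ω := ⟨x, hx, rfl⟩
    have h : ∀ y : G, -e a + e (a + y) = e y := fun y => by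
      rw [map_add, neg_add_cancel_left]
    change -e a + e (a + M.ρ ⟨x, hx⟩) = ((M.transport e).ρ ⟨-e a + e (a + x), _⟩ : G')
    rw [h, ← transport_ρ M e x hx hx']
    congr 2
    exact Subtype.ext (h x).symm

end CayleyMap

/-! ### Hensel lifting of factorizations. -/

section Hensel

variable {R : Type*} [CommRing R]

/-- **Hensel's lemma** for factorizations, along the powers of a principal ideal. -/
theorem Polynomial.exists_monic_factor_modulo_pow [Nontrivial R] (ϖ : R) (f g h s t r : R[X])
    (hg : g.Monic) (hst : s * g + t * h + C ϖ * r = 1) (hf : C ϖ ∣ f - g * h) :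
    ∀ j : ℕ, ∃ g' h' : R[X], g'.Monic ∧ C ϖ ∣ g' - g ∧ C ϖ ∣ h' - h ∧
      C ϖ ^ (j + 1) ∣ f - g' * h'
  | 0 => ⟨g, h, hg, by simp, by simp, by simpa using hf⟩
  | j + 1 => by
    obtain ⟨g', h', hg', ⟨a, ha⟩, ⟨b, hb⟩, ⟨e, he⟩⟩ :=
      Polynomial.exists_monic_factor_modulo_pow ϖ f g h s t r hg hst hf j
    -- The natural corrections are `t * e` for `g'` and `s * e` for `h'`. Only the remainder `c` is
    -- added to `g'`, which keeps it monic; the quotient `d` is moved to the cofactor as `d * h'`.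
    have hdiv := modByMonic_add_div (t * e) g'
    set c := (t * e) %ₘ g'
    set d := (t * e) /ₘ g'
    refine ⟨g' + C ϖ ^ (j + 1) * c, h' + C ϖ ^ (j + 1) * (s * e + d * h'), ?_, ?_, ?_, ?_⟩
    · refine hg'.add_of_left (lt_of_le_of_lt ?_ (degree_modByMonic_lt (t * e) hg'))
      rw [← C_pow, ← smul_eq_C_mul]
      exact degree_smul_le _ _
    · exact ⟨a + C ϖ ^ j * c, by linear_combination ha⟩
    · exact ⟨b + C ϖ ^ j * (s * e + d * h'), by linear_combination hb⟩
    · have hst' : s * g' + t * h' = 1 + C ϖ * (s * a + t * b - r) := by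
        linear_combination hst + s * ha + t * hb
      refine ⟨-e * (s * a + t * b - r) - C ϖ ^ j * c * (s * e + d * h'), ?_⟩
      linear_combination he - C ϖ ^ (j + 1) * h' * hdiv - C ϖ ^ (j + 1) * e * hst'

end Hensel

/-! ### Polynomials modulo a nilpotent element. -/

section Reduction

variable {R K : Type*} [CommRing R] [CommRing K] {f : R →+* K} {ϖ : R}

theorem Polynomial.map_eq_zero_iff_C_dvd (hker : RingHom.ker f = Ideal.span {ϖ}) (q : R[X]) :
    q.map f = 0 ↔ C ϖ ∣ q := by
  rw [← coe_mapRingHom, ← RingHom.mem_ker, ker_mapRingHom, hker, Ideal.map_span,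
    Set.image_singleton, Ideal.mem_span_singleton]

theorem Polynomial.isUnit_of_map_eq_one (hker : RingHom.ker f = Ideal.span {ϖ})
    (hϖ : IsNilpotent ϖ) {q : R[X]} (hq : q.map f = 1) : IsUnit q := by
  obtain ⟨r, hr⟩ := (map_eq_zero_iff_C_dvd hker (q - 1)).1 (by simp [hq])
  rw [← sub_add_cancel q 1, hr]
  exact IsNilpotent.isUnit_add_one ((Commute.all _ _).isNilpotent_mul_right (hϖ.map C))

theorem Polynomial.isUnit_of_isUnit_map (hf : Function.Surjective f)
    (hker : RingHom.ker f = Ideal.span {ϖ}) (hϖ : IsNilpotent ϖ) {q : R[X]}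
    (hq : IsUnit (q.map f)) : IsUnit q := by
  obtain ⟨u, hu⟩ := hq.exists_right_inv
  obtain ⟨v, rfl⟩ := map_surjective f hf u
  rw [← Polynomial.map_mul] at hu
  exact isUnit_of_mul_isUnit_left (isUnit_of_map_eq_one hker hϖ hu)

theorem Polynomial.isCoprime_of_isCoprime_map (hf : Function.Surjective f)
    (hker : RingHom.ker f = Ideal.span {ϖ}) (hϖ : IsNilpotent ϖ) {q r : R[X]}
    (h : IsCoprime (q.map f) (r.map f)) : IsCoprime q r := by
  obtain ⟨a, b, hab⟩ := h
  obtain ⟨a, rfl⟩ := map_surjective f hf a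
  obtain ⟨b, rfl⟩ := map_surjective f hf b
  obtain ⟨u, hu⟩ := (isUnit_of_map_eq_one (q := a * q + b * r) hker hϖ
    (by simpa using hab)).exists_left_inv
  exact ⟨u * a, u * b, by linear_combination hu⟩

theorem Polynomial.irreducible_of_irreducible_map (hf : Function.Surjective f)
    (hker : RingHom.ker f = Ideal.span {ϖ}) (hϖ : IsNilpotent ϖ) {q : R[X]}
    (h : Irreducible (q.map f)) : Irreducible q := by
  refine ⟨fun hq => h.not_isUnit (hq.map (mapRingHom f)), fun a b hab => ?_⟩
  rcases h.isUnit_or_isUnit (a := a.map f) (b := b.map f) (by rw [hab, Polynomial.map_mul])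
    with h | h
  · exact Or.inl (isUnit_of_isUnit_map hf hker hϖ h)
  · exact Or.inr (isUnit_of_isUnit_map hf hker hϖ h)

/-- A monic factor of the reduction of `F` that is coprime to its cofactor lifts to a monic
factor of `F`. -/
theorem Polynomial.exists_monic_dvd_map_eq [Nontrivial K] (hf : Function.Surjective f)
    (hker : RingHom.ker f = Ideal.span {ϖ}) (hϖ : IsNilpotent ϖ) {F : R[X]} {q r : K[X]}
    (hq : q.Monic) (hqr : IsCoprime q r) (hF : F.map f = q * r) :
    ∃ Q : R[X], Q.Monic ∧ Q ∣ F ∧ Q.map f = q := by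
  have : Nontrivial R := f.domain_nontrivial
  obtain ⟨g, hgq, -, hg⟩ := lifts_and_degree_eq_and_monic
    ((mem_lifts q).2 (map_surjective f hf q)) hq
  obtain ⟨h, rfl⟩ := map_surjective f hf r
  obtain ⟨s, t, hst⟩ := hqr
  obtain ⟨s, rfl⟩ := map_surjective f hf s
  obtain ⟨t, rfl⟩ := map_surjective f hf t
  subst hgq
  obtain ⟨m, hm⟩ := (map_eq_zero_iff_C_dvd hker (1 - (s * g + t * h))).1 (by simp [hst])
  obtain ⟨n, hn⟩ := hϖ
  -- Since `ϖ ^ n = 0`, the congruence modulo `ϖ ^ (n + 1)` is an equality.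
  obtain ⟨g', h', hg', hd, -, he⟩ := exists_monic_factor_modulo_pow ϖ F g h s t m hg
    (by linear_combination -hm) ((map_eq_zero_iff_C_dvd hker _).1 (by simp [hF])) n
  refine ⟨g', hg', ⟨h', ?_⟩, ?_⟩
  · rw [← C_pow, pow_succ, hn] at he
    simpa [sub_eq_zero] using he
  · rw [← sub_eq_zero, ← Polynomial.map_sub]
    exact (map_eq_zero_iff_C_dvd hker _).2 hd

/-- The ideal is the preimage, under reduction of coefficients, of the maximal ideal generated by
the irreducible reduction of `q`. -/
theorem Polynomial.isMaximal_span_pair {K : Type*} [Field K] {f : R →+* K}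
    (hf : Function.Surjective f) (hker : RingHom.ker f = Ideal.span {ϖ}) {q : R[X]}
    (h : Irreducible (q.map f)) : (Ideal.span {q, C ϖ}).IsMaximal := by
  have hm : (Ideal.span {q.map f}).IsMaximal := PrincipalIdealRing.isMaximal_of_irreducible h
  have h1 : Ideal.span {q.map f} = (Ideal.span {q}).map (mapRingHom f) := by
    rw [Ideal.map_span, Set.image_singleton, coe_mapRingHom]
  have h2 : Ideal.span {q, C ϖ} = (Ideal.span {q.map f}).comap (mapRingHom f) := by
    rw [h1, Ideal.comap_map_of_surjective _ (map_surjective f hf), ← RingHom.ker_eq_comap_bot,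
      ker_mapRingHom, hker, Ideal.map_span, Set.image_singleton, Ideal.span_insert]
  rw [h2]
  exact Ideal.comap_isMaximal_of_surjective (mapRingHom f) (map_surjective f hf)

end Reduction

/-! ### Ideals above a product of coprime elements. -/

section ChainIdeals

variable {S : Type*} [CommRing S]

theorem mul_one_add_mem_cancel {I : Ideal S} {P a r : S} (hP : IsNilpotent P)
    (h : a * (1 + P * r) ∈ I) : a ∈ I := by
  have hu : IsUnit (1 + P * r) :=
    IsNilpotent.isUnit_one_add ((Commute.all _ _).isNilpotent_mul_right hP)
  exact (I.mul_unit_mem_iff_mem hu).1 h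

/-- If `(q, P)` is maximal and `P ^ k = 0`, the ideals containing `q` are the `(q, P ^ u)`. -/
theorem Ideal.exists_eq_span_pair_pow {P q : S} {k : ℕ} (hP : P ^ k = 0)
    (hm : (Ideal.span {q, P}).IsMaximal) {I : Ideal S} (hq : q ∈ I) :
    ∃ u : Fin (k + 1), I = Ideal.span {q, P ^ (u : ℕ)} := by
  classical
  have hex : ∃ u, P ^ u ∈ I := ⟨k, by rw [hP]; exact I.zero_mem⟩
  have hle : Nat.find hex ≤ k := Nat.find_min' hex (by rw [hP]; exact I.zero_mem)
  refine ⟨⟨Nat.find hex, by omega⟩, le_antisymm (fun a ha => ?_) ?_⟩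
  · have key : ∀ v, v ≤ Nat.find hex → a ∈ Ideal.span {q, P ^ v} := by
      intro v
      induction v with
      | zero => intro _; rw [pow_zero, Ideal.span_pair_comm, Ideal.span_insert]; simp
      | succ v ih =>
        intro hv
        obtain ⟨x, y, rfl⟩ := Ideal.mem_span_pair.1 (ih (by omega))
        -- Otherwise `y` is invertible modulo `(q, P)`, so `I` contains a multiple of `P ^ v` by
        -- some `1 + P * r`. That factor is a unit, and `P ^ v ∈ I` contradicts minimality.
        have hy : y ∈ Ideal.span {q, P} := by
          by_contra hy
          obtain ⟨z, i, hi, hz⟩ := hm.exists_inv hy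
          obtain ⟨c, d, rfl⟩ := Ideal.mem_span_pair.1 hi
          refine Nat.find_min hex (m := v) (by omega) ?_
          refine mul_one_add_mem_cancel (r := -d) ⟨k, hP⟩ ?_
          have h1 : P ^ v * (1 + P * -d) =
              z * (x * q + y * P ^ v) + (P ^ v * c - z * x) * q := by
            linear_combination -P ^ v * hz
          rw [h1]
          exact I.add_mem (I.mul_mem_left _ ha) (I.mul_mem_left _ hq)
        obtain ⟨c, d, rfl⟩ := Ideal.mem_span_pair.1 hy
        exact Ideal.mem_span_pair.2 ⟨x + c * P ^ v, d, by ring⟩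
    exact key _ le_rfl
  · rw [Ideal.span_le, Set.insert_subset_iff, Set.singleton_subset_iff]
    exact ⟨hq, Nat.find_spec hex⟩

/-- If `u < v`, then `P ^ u` times a unit `1 + P * r` would be a multiple of `q`. -/
theorem Ideal.le_of_pow_mem_span_pair {P q : S} {k : ℕ} (hP : P ^ k = 0)
    (hq : ∀ u < k, P ^ u ∉ Ideal.span {q}) {u v : ℕ} (hv : v ≤ k)
    (h : P ^ u ∈ Ideal.span {q, P ^ v}) : v ≤ u := by
  by_contra hlt
  obtain ⟨a, b, hab⟩ := Ideal.mem_span_pair.1 h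
  obtain ⟨c, rfl⟩ : ∃ c, v = u + (c + 1) := ⟨v - u - 1, by omega⟩
  refine hq u (by omega) (mul_one_add_mem_cancel (r := -b * P ^ c) ⟨k, hP⟩ ?_)
  exact Ideal.mem_span_singleton'.2 ⟨a, by linear_combination hab⟩

variable {ι : Type*} [Fintype ι]

/-- An ideal containing a product of pairwise coprime elements `Q i` with `(Q i, P)` maximal
and `P` nilpotent is an intersection of ideals `(Q i, P ^ J i)`. -/
theorem Ideal.exists_eq_iInf_span_pair_pow {P : S} {k : ℕ} (hP : P ^ k = 0) {Q : ι → S}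
    (hm : ∀ i, (Ideal.span {Q i, P}).IsMaximal) (hQ : Pairwise (Function.onFun IsCoprime Q))
    {I : Ideal S} (hI : ∏ i, Q i ∈ I) :
    ∃ J : ι → Fin (k + 1), I = ⨅ i, Ideal.span {Q i, P ^ (J i : ℕ)} := by
  choose J hJ using fun i => Ideal.exists_eq_span_pair_pow hP (hm i)
    (I := I ⊔ Ideal.span {Q i}) (Ideal.mem_sup_right (Ideal.mem_span_singleton_self _))
  refine ⟨J, ?_⟩
  simp_rw [← hJ]
  refine le_antisymm (le_iInf fun i => le_sup_left) ?_
  have hcop : (↑(Finset.univ : Finset ι) : Set ι).Pairwise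
      (Function.onFun IsCoprime fun i => I ⊔ Ideal.span {Q i}) := by
    intro i _ j _ hij
    have h := (Ideal.isCoprime_span_singleton_iff _ _).2 (hQ hij)
    refine Ideal.isCoprime_iff_sup_eq.2 (eq_top_iff.2 ?_)
    rw [← Ideal.isCoprime_iff_sup_eq.1 h]
    exact sup_le_sup le_sup_right le_sup_right
  -- Over all indices the right side is `I`, while the product of the comaximal ideals on the left
  -- is their intersection.
  have hprod : ∀ s : Finset ι, ∏ i ∈ s, (I ⊔ Ideal.span {Q i}) ≤
      I ⊔ Ideal.span {∏ i ∈ s, Q i} := by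
    classical
    intro s
    induction s using Finset.induction_on with
    | empty => simp
    | insert i s hi ih =>
      rw [Finset.prod_insert hi, Finset.prod_insert hi, ← Ideal.span_singleton_mul_span_singleton]
      refine (Ideal.mul_mono_right ih).trans ?_
      rw [Ideal.sup_mul, Ideal.mul_sup (Ideal.span {Q i})]
      refine sup_le (le_sup_of_le_left Ideal.mul_le_left)
        (sup_le (le_sup_of_le_left Ideal.mul_le_right) le_sup_right)
  have h2 := Ideal.prod_eq_iInf_of_pairwise_isCoprime hcop
  have h3 := hprod Finset.univ
  rw [h2, sup_eq_left.2 ((Ideal.span_singleton_le_iff_mem _).2 hI)] at h3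
  simpa using h3

/-- The element `a * E` below is `1` modulo `Q i` and divisible by every other `Q j`. Its multiple
by `P ^ J i` lies in the intersection for `J`, so an inclusion of intersections can be compared at
the single index `i`. -/
theorem Ideal.iInf_span_pair_pow_injective {P : S} {k : ℕ} (hP : P ^ k = 0) {Q : ι → S}
    (hQk : ∀ i, ∀ u < k, P ^ u ∉ Ideal.span {Q i}) (hQ : Pairwise (Function.onFun IsCoprime Q)) :
    Function.Injective fun (J : ι → Fin (k + 1)) => ⨅ i, Ideal.span {Q i, P ^ (J i : ℕ)} := by
  classical
  have key : ∀ J J' : ι → Fin (k + 1), (⨅ i, Ideal.span {Q i, P ^ (J i : ℕ)}) ≤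
      (⨅ i, Ideal.span {Q i, P ^ (J' i : ℕ)}) → J' ≤ J := by
    intro J J' hle i
    have hc : IsCoprime (∏ j ∈ Finset.univ.erase i, Q j) (Q i) :=
      IsCoprime.prod_left fun j hj => hQ (Finset.ne_of_mem_erase hj)
    obtain ⟨a, b, hab⟩ := hc
    set E := ∏ j ∈ Finset.univ.erase i, Q j with hE
    have hmem : P ^ (J i : ℕ) * (a * E) ∈ ⨅ i, Ideal.span {Q i, P ^ (J i : ℕ)} := by
      refine (Submodule.mem_iInf _).2 fun j => ?_
      rcases eq_or_ne j i with rfl | hj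
      · exact Ideal.mul_mem_right _ _ (Ideal.subset_span (by simp))
      · refine Ideal.mul_mem_left _ _ (Ideal.mul_mem_left _ _ ?_)
        exact Ideal.mem_of_dvd _
          (Finset.dvd_prod_of_mem Q (Finset.mem_erase.2 ⟨hj, Finset.mem_univ j⟩))
          (Ideal.subset_span (by simp))
    have h := (Submodule.mem_iInf _).1 (hle hmem) i
    refine Ideal.le_of_pow_mem_span_pair hP (hQk i) (by omega) (u := J i) ?_
    have h1 : P ^ (J i : ℕ) = P ^ (J i : ℕ) * (a * E) + P ^ (J i : ℕ) * b * Q i := by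
      linear_combination -P ^ (J i : ℕ) * hab
    rw [h1]
    exact Ideal.add_mem _ h (Ideal.mul_mem_left _ _ (Ideal.subset_span (by simp)))
  intro J J' h
  exact le_antisymm (key J' J h.ge) (key J J' h.le)

end ChainIdeals

/-! ### Roots of unity and Frobenius orbits. -/

theorem IsPrimitiveRoot.pow_eq_pow_iff_cast {R : Type*} [CommMonoid R] {ζ : R} {d : ℕ}
    (h : IsPrimitiveRoot ζ d) (hd : 0 < d) {a b : ℕ} :
    ζ ^ a = ζ ^ b ↔ (a : ZMod d) = b := by
  rw [ZMod.natCast_eq_natCast_iff, Nat.ModEq, ← pow_mod_orderOf ζ a, ← pow_mod_orderOf ζ b,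
    ← h.eq_orderOf]
  exact ⟨fun H => h.pow_inj (Nat.mod_lt _ hd) (Nat.mod_lt _ hd) H, fun H => by rw [H]⟩

theorem IsCosetReps.eq_of_mul_pow_eq {p d : ℕ} {S : Set (ZMod d)ˣ} (hS : IsCosetReps p d S)
    (hpd : Nat.Coprime p d) {u v : (ZMod d)ˣ} (hu : u ∈ S) (hv : v ∈ S) {i j : ℕ}
    (h : (u : ZMod d) * (p : ZMod d) ^ i = v * (p : ZMod d) ^ j) : u = v := by
  obtain ⟨w, -, hw⟩ := hS (u * ZMod.unitOfCoprime p hpd ^ i)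
  rw [hw u ⟨hu, i, by simp⟩, hw v ⟨hv, j, by simp [h]⟩]

section Conjugates

variable {p : ℕ} [Fact p.Prime] {K : Type*} [Field K]

/-- The product of `X - ξ ^ (p ^ j)` for `j < o`. -/
noncomputable def conjProd (p o : ℕ) (ξ : K) : K[X] :=
  ∏ j ∈ Finset.range o, (X - C (ξ ^ p ^ j))

theorem conjProd_monic (p o : ℕ) (ξ : K) : (conjProd p o ξ).Monic :=
  monic_prod_of_monic _ _ fun _ _ => monic_X_sub_C _

theorem conjProd_eval_eq_zero_iff (p o : ℕ) (ξ y : K) :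
    (conjProd p o ξ).eval y = 0 ↔ ∃ j < o, y = ξ ^ p ^ j := by
  simp [conjProd, eval_prod, Finset.prod_eq_zero_iff, sub_eq_zero]

/-- Frobenius shifts the index of each factor by one, and the orbit closes up because `ξ ^ p ^ o =
ξ`. -/
theorem map_frobenius_conjProd [CharP K p] {o : ℕ} {ξ : K} (ho : ξ ^ p ^ o = ξ) :
    (conjProd p o ξ).map (frobenius K p) = conjProd p o ξ := by
  have h1 : (conjProd p o ξ).map (frobenius K p) =
      ∏ j ∈ Finset.range o, (X - C (ξ ^ p ^ (j + 1))) := by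
    simp [conjProd, Polynomial.map_prod, frobenius_def, ← pow_mul, pow_succ, mul_comm]
  have h2 := Finset.prod_range_succ' (fun j => (X - C (ξ ^ p ^ j) : K[X])) o
  rw [Finset.prod_range_succ, ho, pow_zero, pow_one, ← h1] at h2
  exact (mul_right_cancel₀ (X_sub_C_ne_zero ξ) h2).symm

variable [Algebra (ZMod p) K]

theorem aeval_pow_char (f : (ZMod p)[X]) (x : K) (j : ℕ) :
    aeval (x ^ p ^ j) f = (aeval x f) ^ p ^ j := by
  induction j with
  | zero => simp
  | succ j ih =>
    rw [pow_succ, pow_mul, pow_mul, ← ih, ← expand_aeval, ZMod.expand_card, map_pow]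

theorem exists_map_eq_of_map_frobenius_eq [CharP K p] {f : K[X]}
    (hf : f.map (frobenius K p) = f) : ∃ g : (ZMod p)[X], g.map (algebraMap (ZMod p) K) = f := by
  rw [← mem_lifts, lifts_iff_coeff_lifts]
  intro i
  have h : f.coeff i ∈ (⊥ : Subfield K) := by
    rw [Subfield.mem_bot_iff_pow_eq_self K p, ← frobenius_def, ← coeff_map, hf]
  obtain ⟨n, hn⟩ := (mem_bot_iff_intCast p K).1 h
  exact ⟨n, by simpa using hn⟩

/-- For a primitive `d`-th root of unity `ξ`, the product over the orbit under Frobenius is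
the minimal polynomial. -/
theorem exists_irreducible_map_eq_conjProd [CharP K p] {ξ : K} {d : ℕ} (hd : 0 < d)
    (hpd : Nat.Coprime p d) (hξ : IsPrimitiveRoot ξ d) :
    ∃ q : (ZMod p)[X], q.Monic ∧ Irreducible q ∧ q ∣ X ^ d - 1 ∧
      q.map (algebraMap (ZMod p) K) = conjProd p (orderOf (p : ZMod d)) ξ := by
  have ho : ξ ^ p ^ orderOf (p : ZMod d) = ξ := by
    conv_rhs => rw [← pow_one ξ]
    rw [hξ.pow_eq_pow_iff_cast hd]
    push_cast
    exact pow_orderOf_eq_one _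
  obtain ⟨q, hq⟩ := exists_map_eq_of_map_frobenius_eq (map_frobenius_conjProd ho)
  have hd1 : aeval ξ (X ^ d - 1 : (ZMod p)[X]) = 0 := by simp [hξ.pow_eq_one]
  have hint : IsIntegral (ZMod p) ξ :=
    ⟨X ^ d - 1, monic_X_pow_sub_C 1 hd.ne', by simpa [aeval_def] using hd1⟩
  have hqm : q.Monic := by
    have := conjProd_monic p (orderOf (p : ZMod d)) ξ
    rw [← hq] at this
    exact (algebraMap (ZMod p) K).injective.monic_map_iff.2 this
  -- As `p` is a unit modulo `d`, the order is not the default value `0`, which would make the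
  -- product empty.
  have hpos : 0 < orderOf (p : ZMod d) := by
    have : NeZero d := ⟨hd.ne'⟩
    have h := (ZMod.unitOfCoprime p hpd).isUnit
    rw [ZMod.coe_unitOfCoprime] at h
    obtain ⟨u, hu⟩ := h
    rw [← hu, orderOf_units]
    exact orderOf_pos u
  have hroot : aeval ξ q = 0 := by
    rw [aeval_def, ← eval_map, hq, conjProd_eval_eq_zero_iff]
    exact ⟨0, hpos, by simp⟩
  -- The orbit consists of distinct roots of the minimal polynomial, which in turn divides `q`;
  -- comparing degrees gives equality.
  have hdvd : conjProd p (orderOf (p : ZMod d)) ξ ∣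
      (minpoly (ZMod p) ξ).map (algebraMap (ZMod p) K) := by
    refine Finset.prod_dvd_of_coprime (fun i hi j hj hij => ?_) fun j _ => ?_
    · refine isCoprime_X_sub_C_of_isUnit_sub (IsUnit.mk0 _ (sub_ne_zero.2 fun h => hij ?_))
      rw [hξ.pow_eq_pow_iff_cast hd] at h
      push_cast at h
      exact pow_injOn_Iio_orderOf (by simpa using hi) (by simpa using hj) h
    · rw [dvd_iff_isRoot, IsRoot.def, eval_map, ← aeval_def, aeval_pow_char, minpoly.aeval,
        zero_pow (pow_ne_zero _ (Fact.out : p.Prime).ne_zero)]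
  have hle : q.natDegree ≤ (minpoly (ZMod p) ξ).natDegree := by
    have h := natDegree_le_of_dvd hdvd ((minpoly.monic hint).map _).ne_zero
    rwa [← hq, natDegree_map, natDegree_map] at h
  have heq : q = minpoly (ZMod p) ξ :=
    eq_of_monic_of_dvd_of_natDegree_le (minpoly.monic hint) hqm (minpoly.dvd _ _ hroot) hle
  exact ⟨q, hqm, heq ▸ minpoly.irreducible hint, heq ▸ minpoly.dvd _ _ hd1, hq⟩

end Conjugates

/-! ### Existence and reduction of the lifted factors. -/

section QLift

variable {p : ℕ} [Fact p.Prime] {n k : ℕ} {hk : k ≠ 0}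

theorem castHom_pow_surjective (hk : k ≠ 0) :
    Function.Surjective (ZMod.castHom (dvd_pow_self p hk) (ZMod p)) :=
  ZMod.castHom_surjective _

theorem ker_castHom_pow (hk : k ≠ 0) :
    RingHom.ker (ZMod.castHom (dvd_pow_self p hk) (ZMod p)) =
      Ideal.span {(p : ZMod (p ^ k))} := by
  ext x
  rw [RingHom.mem_ker, Ideal.mem_span_singleton]
  obtain ⟨a, rfl⟩ := ZMod.natCast_zmod_surjective x
  rw [map_natCast, ZMod.natCast_eq_zero_iff]
  constructor
  · exact fun h => Nat.cast_dvd_cast h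
  · intro h
    have := map_dvd (ZMod.castHom (dvd_pow_self p hk) (ZMod p)) h
    rw [map_natCast, map_natCast, CharP.cast_eq_zero, zero_dvd_iff] at this
    exact (ZMod.natCast_eq_zero_iff _ _).1 this

theorem natCast_prime_pow_eq_zero (p k : ℕ) : (p : ZMod (p ^ k)) ^ k = 0 := by
  rw [← Nat.cast_pow, CharP.cast_eq_zero]

theorem map_redHom (Q : (ZMod (p ^ k))[X]) : Q.map (redHom p k hk) =
    (Q.map (ZMod.castHom (dvd_pow_self p hk) (ZMod p))).map
      (algebraMap (ZMod p) (AlgebraicClosure (ZMod p))) := by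
  rw [Polynomial.map_map]
  rfl

theorem qBar_eq_conjProd (η : ℕ → AlgebraicClosure (ZMod p)) (l : Σ d : ℕ, (ZMod d)ˣ) :
    qBar p η l = conjProd p (orderOf (p : ZMod l.1)) (η l.1 ^ (l.2 : ZMod l.1).val) := by
  simp [qBar, conjProd, pow_mul]

theorem isPrimitiveRoot_pow_unit_val {R : Type*} [CommMonoid R] {d : ℕ} {ζ : R}
    (hζ : IsPrimitiveRoot ζ d) (u : (ZMod d)ˣ) :
    IsPrimitiveRoot (ζ ^ (u : ZMod d).val) d :=
  hζ.pow_of_coprime _ (ZMod.val_coe_unit_coprime u)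

theorem separable_X_pow_sub_one_zmod {N : ℕ} (hN : Nat.Coprime p N) :
    (X ^ N - 1 : (ZMod p)[X]).Separable := by
  refine separable_X_pow_sub_C (1 : ZMod p) ?_ one_ne_zero
  rw [Ne, ZMod.natCast_eq_zero_iff]
  exact (Nat.Prime.coprime_iff_not_dvd Fact.out).1 hN

/-- Separability of `X ^ (2 * n) - 1` modulo `p` makes `q_λ` coprime to its cofactor, so Hensel's
lemma applies. Existence is what gives the choice in `qLift` its defining property. -/
theorem exists_isQLift (hk : k ≠ 0) (hn : 0 < n) (hpn : Nat.Coprime p (2 * n))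
    {η : ℕ → AlgebraicClosure (ZMod p)} {l : Σ d : ℕ, (ZMod d)ˣ} (hl : l.1 ∣ 2 * n)
    (hη : IsPrimitiveRoot (η l.1) l.1) : ∃ Q, IsQLift p n k hk η l Q := by
  have hd : 0 < l.1 := Nat.pos_of_dvd_of_pos hl (by omega)
  have : CharP (AlgebraicClosure (ZMod p)) p := charP_of_injective_algebraMap
    (algebraMap (ZMod p) (AlgebraicClosure (ZMod p))).injective p
  obtain ⟨q, hqm, hqi, hqd, hq⟩ := exists_irreducible_map_eq_conjProd (p := p) hd
    (hpn.coprime_dvd_right hl) (isPrimitiveRoot_pow_unit_val hη l.2)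
  obtain ⟨r, hr⟩ : q ∣ X ^ (2 * n) - 1 := hqd.trans (by
    obtain ⟨c, hc⟩ := hl
    rw [hc, pow_mul]
    simpa using sub_dvd_pow_sub_pow (X ^ l.1 : (ZMod p)[X]) 1 c)
  have hcop : IsCoprime q r := by
    have h := separable_X_pow_sub_one_zmod hpn
    rw [hr] at h
    exact h.isCoprime
  have hnil : IsNilpotent (p : ZMod (p ^ k)) := ⟨k, natCast_prime_pow_eq_zero p k⟩
  obtain ⟨Q, hQm, hQd, hQ⟩ := exists_monic_dvd_map_eq (castHom_pow_surjective hk)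
    (ker_castHom_pow hk) hnil (F := X ^ (2 * n) - 1) hqm hcop (by simpa using hr)
  refine ⟨Q, hQm, ?_, hQd, ?_⟩
  · exact irreducible_of_irreducible_map (castHom_pow_surjective hk) (ker_castHom_pow hk) hnil
      (by rwa [hQ])
  · rw [map_redHom, hQ, hq, qBar_eq_conjProd]

theorem irreducible_map_qLift (hk : k ≠ 0) (hn : 0 < n) (hpn : Nat.Coprime p (2 * n))
    {η : ℕ → AlgebraicClosure (ZMod p)} {l : Σ d : ℕ, (ZMod d)ˣ} (hl : l.1 ∣ 2 * n)
    (hη : IsPrimitiveRoot (η l.1) l.1) :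
    Irreducible ((qLift p n k hk η l).map (ZMod.castHom (dvd_pow_self p hk) (ZMod p))) := by
  have hQ : IsQLift p n k hk η l (qLift p n k hk η l) :=
    Classical.epsilon_spec (exists_isQLift hk hn hpn hl hη)
  have hd : 0 < l.1 := Nat.pos_of_dvd_of_pos hl (by omega)
  have : CharP (AlgebraicClosure (ZMod p)) p := charP_of_injective_algebraMap
    (algebraMap (ZMod p) (AlgebraicClosure (ZMod p))).injective p
  obtain ⟨q, hqm, hqi, hqd, hq⟩ := exists_irreducible_map_eq_conjProd (p := p) hd
    (hpn.coprime_dvd_right hl) (isPrimitiveRoot_pow_unit_val hη l.2)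
  have h := hQ.2.2.2
  rw [map_redHom, qBar_eq_conjProd, ← hq] at h
  rwa [map_injective _ (algebraMap (ZMod p) (AlgebraicClosure (ZMod p))).injective h]

/-- A monic polynomial of positive degree divides no nonzero constant, and `p ^ u ≠ 0` in `ℤ/p^k`
for `u < k`. -/
theorem pow_notMem_span_of_monic {q : (ZMod (p ^ k))[X]} (hq : q.Monic) (hdeg : 0 < q.natDegree)
    {u : ℕ} (hu : u < k) : (p : (ZMod (p ^ k))[X]) ^ u ∉ Ideal.span {q} := by
  rw [Ideal.mem_span_singleton, ← map_natCast C, ← C_pow]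
  intro h
  have h0 : C ((p : ZMod (p ^ k)) ^ u) = 0 := by
    by_contra h0
    exact hq.not_dvd_of_natDegree_lt h0 ((natDegree_C _).trans_lt hdeg) h
  rw [C_eq_zero, ← Nat.cast_pow, ZMod.natCast_eq_zero_iff,
    Nat.pow_dvd_pow_iff_le_right (Fact.out : p.Prime).one_lt] at h0
  omega

end QLift

/-! ### The polynomials `q_λ` and the roots of `x ^ n + 1`. -/

section Family

variable {p : ℕ} [Fact p.Prime] {n k : ℕ}
  {η : ℕ → AlgebraicClosure (ZMod p)} {Ξ : (d : ℕ) → Set (ZMod d)ˣ}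

theorem finite_lambdaIdx (hn : 0 < n) (Ξ : (d : ℕ) → Set (ZMod d)ˣ) :
    Finite (LambdaIdx n Ξ) := by
  have : ∀ d : Nat.divisors (2 * n), NeZero (d : ℕ) := fun d =>
    ⟨(Nat.pos_of_mem_divisors d.2).ne'⟩
  refine Finite.of_injective
    (fun l : LambdaIdx n Ξ => (⟨⟨l.1.1, Nat.mem_divisors.2 ⟨l.2.1, by omega⟩⟩, l.1.2⟩ :
      Σ d : Nat.divisors (2 * n), (ZMod d)ˣ)) ?_
  rintro ⟨⟨d, u⟩, h⟩ ⟨⟨d', u'⟩, h'⟩ H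
  simp only [Sigma.mk.injEq, Subtype.mk.injEq] at H
  obtain ⟨rfl, H⟩ := H
  cases H
  rfl

/-- The polynomials `q_λ` have no common roots. -/
theorem isCoprime_qBar (hn : 0 < n) (hpn : Nat.Coprime p (2 * n))
    (hΞ : ∀ d : ℕ, d ∣ 2 * n → ¬ d ∣ n → IsCosetReps p d (Ξ d))
    (hη : ∀ d : ℕ, d ∣ 2 * n → ¬ d ∣ n → IsPrimitiveRoot (η d) d)
    {l l' : LambdaIdx n Ξ} (hll : l ≠ l') : IsCoprime (qBar p η l.1) (qBar p η l'.1) := by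
  refine IsCoprime.prod_left fun i _ => IsCoprime.prod_right fun j _ => ?_
  refine isCoprime_X_sub_C_of_isUnit_sub (IsUnit.mk0 _ (sub_ne_zero.2 fun h => hll ?_))
  obtain ⟨⟨d, u⟩, hd, hdn, hu⟩ := l
  obtain ⟨⟨d', u'⟩, hd', hdn', hu'⟩ := l'
  dsimp only at hd hdn hu hd' hdn' hu' h
  have hpos : 0 < d := Nat.pos_of_dvd_of_pos hd (by omega)
  have hpos' : 0 < d' := Nat.pos_of_dvd_of_pos hd' (by omega)
  have hpd := hpn.coprime_dvd_right hd
  -- A common root has order both `d` and `d'`. Once these agree, `u` and `u'` differ by powers of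
  -- `p` and represent the same coset.
  have h1 := (isPrimitiveRoot_pow_unit_val (hη d hd hdn) u).pow_of_coprime (p ^ i)
    (hpd.pow_left i)
  have h2 := (isPrimitiveRoot_pow_unit_val (hη d' hd' hdn') u').pow_of_coprime (p ^ j)
    ((hpn.coprime_dvd_right hd').pow_left j)
  rw [← pow_mul] at h1 h2
  rw [h] at h1
  obtain rfl := h1.unique h2
  rw [(hη d hd hdn).pow_eq_pow_iff_cast hpos] at h
  have : NeZero d := ⟨hpos.ne'⟩
  push_cast at h
  rw [ZMod.natCast_zmod_val, ZMod.natCast_zmod_val] at h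
  obtain rfl := (hΞ d hd hdn).eq_of_mul_pow_eq hpd hu hu' h
  rfl

/-- As `p` is odd, `y ^ n = -1 ≠ 1`, so the order `d` of `y` divides `2 * n` but not `n`. Then `y`
is a power of `η d` with exponent prime to `d`, and the representative of its coset gives `λ`. -/
theorem exists_qBar_eval_eq_zero (hp : p ≠ 2) (hn : 0 < n)
    (hΞ : ∀ d : ℕ, d ∣ 2 * n → ¬ d ∣ n → IsCosetReps p d (Ξ d))
    (hη : ∀ d : ℕ, d ∣ 2 * n → ¬ d ∣ n → IsPrimitiveRoot (η d) d)
    (hpn : Nat.Coprime p (2 * n))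
    {y : AlgebraicClosure (ZMod p)} (hy : y ^ n = -1) :
    ∃ l : LambdaIdx n Ξ, (qBar p η l.1).eval y = 0 := by
  have hchar : CharP (AlgebraicClosure (ZMod p)) p := charP_of_injective_algebraMap
    (algebraMap (ZMod p) (AlgebraicClosure (ZMod p))).injective p
  have hy2 : y ^ (2 * n) = 1 := by rw [mul_comm, pow_mul, hy]; simp
  have hd : orderOf y ∣ 2 * n := orderOf_dvd_of_pow_eq_one hy2
  have hdn : ¬ orderOf y ∣ n := by
    intro h
    rw [orderOf_dvd_iff_pow_eq_one.1 h] at hy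
    exact Ring.neg_one_ne_one_of_char_ne_two (by rwa [ringChar.eq _ p]) hy.symm
  have hpos : 0 < orderOf y := Nat.pos_of_dvd_of_pos hd (by omega)
  have hprim := IsPrimitiveRoot.orderOf y
  have hη' := hη _ hd hdn
  have hΞ' := hΞ _ hd hdn
  have hpd := hpn.coprime_dvd_right hd
  generalize orderOf y = d at *
  have : NeZero d := ⟨hpos.ne'⟩
  obtain ⟨i, hi, rfl⟩ := hη'.eq_pow_of_pow_eq_one hprim.pow_eq_one
  rw [hη'.pow_iff_coprime hpos] at hprim
  obtain ⟨u, ⟨hu, j, hj⟩, -⟩ := hΞ' (ZMod.unitOfCoprime i hprim)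
  rw [ZMod.coe_unitOfCoprime] at hj
  refine ⟨⟨⟨d, u⟩, hd, hdn, hu⟩, ?_⟩
  rw [qBar_eq_conjProd, conjProd_eval_eq_zero_iff]
  have ho : 0 < orderOf (p : ZMod d) := by
    rw [← ZMod.coe_unitOfCoprime p hpd, orderOf_units]
    exact orderOf_pos _
  -- The exponent `j` is arbitrary, whereas the product defining `qBar` runs over one period.
  refine ⟨j % orderOf (p : ZMod d), Nat.mod_lt _ ho, ?_⟩
  rw [← pow_mul, hη'.pow_eq_pow_iff_cast hpos]
  push_cast
  rw [pow_mod_orderOf, ZMod.natCast_zmod_val, hj]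

theorem X_pow_add_one_dvd_prod_qBar [Fintype (LambdaIdx n Ξ)] (hp : p ≠ 2) (hn : 0 < n)
    (hpn : Nat.Coprime p (2 * n))
    (hΞ : ∀ d : ℕ, d ∣ 2 * n → ¬ d ∣ n → IsCosetReps p d (Ξ d))
    (hη : ∀ d : ℕ, d ∣ 2 * n → ¬ d ∣ n → IsPrimitiveRoot (η d) d) :
    X ^ n + 1 ∣ ∏ l : LambdaIdx n Ξ, qBar p η l.1 := by
  have hchar : CharP (AlgebraicClosure (ZMod p)) p := charP_of_injective_algebraMap
    (algebraMap (ZMod p) (AlgebraicClosure (ZMod p))).injective p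
  have hne : ∏ l : LambdaIdx n Ξ, qBar p η l.1 ≠ 0 :=
    Finset.prod_ne_zero_iff.2 fun l _ => by
      rw [qBar_eq_conjProd]
      exact (conjProd_monic _ _ _).ne_zero
  have hsep : (X ^ n + 1 : (AlgebraicClosure (ZMod p))[X]).Separable := by
    have h := separable_X_pow_sub_C (n := n) (-1 : AlgebraicClosure (ZMod p)) (by
      rw [Ne, CharP.cast_eq_zero_iff _ p]
      exact (Nat.Prime.coprime_iff_not_dvd Fact.out).1 (hpn.coprime_dvd_right ⟨2, by ring⟩))
      (by simp)
    simpa using h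
  refine ((IsAlgClosed.splits _).dvd_iff_roots_le_roots hsep.ne_zero hne).2 ?_
  refine (Multiset.le_iff_subset (nodup_roots hsep)).2 fun y hy => ?_
  have hy' : y ^ n = -1 := by
    have := (mem_roots'.1 hy).2
    simpa [add_eq_zero_iff_eq_neg] using this
  obtain ⟨l, hl⟩ := exists_qBar_eval_eq_zero hp hn hΞ hη hpn hy'
  refine mem_roots'.2 ⟨hne, ?_⟩
  rw [IsRoot.def, eval_prod]
  exact Finset.prod_eq_zero (Finset.mem_univ l) hl

end Family

theorem AddMonoidHom.exists_addEquiv_of_ker_eq {A B C : Type*} [AddCommGroup A] [AddCommGroup B]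
    [AddCommGroup C] {f : A →+ B} {g : A →+ C} (hf : Function.Surjective f)
    (hg : Function.Surjective g) (h : f.ker = g.ker) : ∃ e : B ≃+ C, ∀ a, e (f a) = g a := by
  refine ⟨(QuotientAddGroup.quotientKerEquivOfSurjective f hf).symm.trans
    ((QuotientAddGroup.quotientAddEquivOfEq h).trans
      (QuotientAddGroup.quotientKerEquivOfSurjective g hg)), fun a => ?_⟩
  have h1 : (QuotientAddGroup.quotientKerEquivOfSurjective f hf).symm (f a) =
      QuotientAddGroup.mk a := by
    rw [AddEquiv.symm_apply_eq]
    rfl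
  rw [AddEquiv.trans_apply, h1]
  rfl

/-! ### Cyclic modules over a polynomial ring. -/

section CyclicModule

variable {R G : Type*} [CommRing R] [AddCommGroup G] [Module R G]

/-- Evaluation of polynomials in the endomorphism `α` at the vector `w`. -/
noncomputable def evalVec (α : Module.End R G) (w : G) : R[X] →+ G where
  toFun s := aeval α s w
  map_zero' := by simp
  map_add' := by simp

theorem evalVec_mul (α : Module.End R G) (w : G) (s t : R[X]) :
    evalVec α w (s * t) = aeval α s (evalVec α w t) := by
  simp [evalVec]

theorem evalVec_X_mul (α : Module.End R G) (w : G) (t : R[X]) :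
    evalVec α w (X * t) = α (evalVec α w t) := by
  rw [evalVec_mul, aeval_X]

theorem evalVec_one (α : Module.End R G) (w : G) : evalVec α w 1 = w := by
  simp [evalVec]

theorem evalVec_C (α : Module.End R G) (w : G) (a : R) : evalVec α w (C a) = a • w := by
  simp [evalVec]

/-- The annihilator of `w` for the action of polynomials through `α`. -/
noncomputable def annVec (α : Module.End R G) (w : G) : Ideal R[X] where
  carrier := {s | evalVec α w s = 0}
  add_mem' {s t} hs ht := by
    change evalVec α w (s + t) = 0
    rw [map_add, hs, ht, add_zero]
  zero_mem' := map_zero _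
  smul_mem' s t ht := by
    change evalVec α w (s * t) = 0
    rw [evalVec_mul, ht, map_zero]

theorem mem_annVec {α : Module.End R G} {w : G} {s : R[X]} :
    s ∈ annVec α w ↔ evalVec α w s = 0 := Iff.rfl

end CyclicModule

/-! ### The group of the map as a cyclic module. -/

section SignedCycle

variable {R G : Type*} [CommRing R] [AddCommGroup G] [Module R G] {M : CayleyMap G} {n : ℕ}
  {w : ℕ → G} {α : Module.End R G}

theorem CayleyMap.HasSignedCycle.evalVec_X_pow (h : M.HasSignedCycle n w)
    (hα : ∀ x : M.Ω, α x = M.ρ x) : ∀ i, i < n → evalVec α (w 1) (X ^ i) = w (i + 1)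
  | 0, _ => by rw [pow_zero, evalVec_one]
  | i + 1, hi => by
    obtain ⟨hm, hr⟩ := (h.2.1 (i + 1) (by omega) hi).1
    rw [pow_succ', evalVec_X_mul, h.evalVec_X_pow hα i (by omega), hα ⟨_, hm⟩, hr]

/-- The sign change `ρ (w n) = -w 1` closing the cycle reads `α ^ n (w 1) = -w 1`. -/
theorem CayleyMap.HasSignedCycle.X_pow_add_one_mem (h : M.HasSignedCycle n w) (hn : 1 ≤ n)
    (hα : ∀ x : M.Ω, α x = M.ρ x) : X ^ n + 1 ∈ annVec α (w 1) := by
  obtain ⟨n, rfl⟩ : ∃ m, n = m + 1 := ⟨n - 1, by omega⟩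
  obtain ⟨hm, hr⟩ := h.2.2.1
  rw [mem_annVec, map_add, evalVec_one, pow_succ', evalVec_X_mul,
    h.evalVec_X_pow hα n (by omega), hα ⟨_, hm⟩, hr, neg_add_cancel]

theorem CayleyMap.HasSignedCycle.evalVec_surjective (h : M.HasSignedCycle n w)
    (hα : ∀ x : M.Ω, α x = M.ρ x) : Function.Surjective (evalVec α (w 1)) := by
  rw [← AddMonoidHom.range_eq_top, eq_top_iff, ← M.closure_eq_top, AddSubgroup.closure_le, h.1]
  rintro _ ⟨i, h1, h2, hx⟩
  have hi : w i ∈ (evalVec α (w 1)).range := by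
    refine ⟨X ^ (i - 1), ?_⟩
    rw [h.evalVec_X_pow hα _ (by omega)]
    congr 1
    omega
  rcases hx with rfl | rfl
  · exact hi
  · exact AddSubgroup.neg_mem _ hi

end SignedCycle

/-! ### Factorization of `x ^ n + 1` and the group `G_J`. -/

section Family

variable {p : ℕ} [Fact p.Prime] {n k : ℕ} {hk : k ≠ 0}
  {η : ℕ → AlgebraicClosure (ZMod p)} {Ξ : (d : ℕ) → Set (ZMod d)ˣ}

theorem isCoprime_qLift (hn : 0 < n) (hpn : Nat.Coprime p (2 * n))
    (hΞ : ∀ d : ℕ, d ∣ 2 * n → ¬ d ∣ n → IsCosetReps p d (Ξ d))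
    (hη : ∀ d : ℕ, d ∣ 2 * n → ¬ d ∣ n → IsPrimitiveRoot (η d) d) :
    Pairwise (Function.onFun IsCoprime fun l : LambdaIdx n Ξ => qLift p n k hk η l.1) := by
  intro l l' hll
  have hQ : ∀ l : LambdaIdx n Ξ, IsQLift p n k hk η l.1 (qLift p n k hk η l.1) := fun l =>
    Classical.epsilon_spec (exists_isQLift hk hn hpn l.2.1 (hη _ l.2.1 l.2.2.1))
  refine isCoprime_of_isCoprime_map (castHom_pow_surjective hk) (ker_castHom_pow hk)
    ⟨k, natCast_prime_pow_eq_zero p k⟩ ?_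
  rw [← isCoprime_map (algebraMap (ZMod p) (AlgebraicClosure (ZMod p))), ← map_redHom (hk := hk),
    ← map_redHom (hk := hk), (hQ l).2.2.2, (hQ l').2.2.2]
  exact isCoprime_qBar hn hpn hΞ hη hll

/-- The factor divides `(X ^ n - 1) * (X ^ n + 1)`. It is coprime to `X ^ n - 1`, since its
reduction is irreducible and has a root of order `d ∤ n`. -/
theorem qLift_dvd_X_pow_add_one (hn : 0 < n) (hpn : Nat.Coprime p (2 * n))
    {l : Σ d : ℕ, (ZMod d)ˣ} (hl : l.1 ∣ 2 * n) (hl' : ¬ l.1 ∣ n)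
    (hη : IsPrimitiveRoot (η l.1) l.1) : qLift p n k hk η l ∣ X ^ n + 1 := by
  have hQ : IsQLift p n k hk η l (qLift p n k hk η l) :=
    Classical.epsilon_spec (exists_isQLift hk hn hpn hl hη)
  have hcop : IsCoprime (qLift p n k hk η l) (X ^ n - 1) := by
    refine isCoprime_of_isCoprime_map (castHom_pow_surjective hk) (ker_castHom_pow hk)
      ⟨k, natCast_prime_pow_eq_zero p k⟩ ?_
    refine (irreducible_map_qLift hk hn hpn hl hη).coprime_iff_not_dvd.2 fun h => hl' ?_
    have h1 := Polynomial.map_dvd (algebraMap (ZMod p) (AlgebraicClosure (ZMod p))) h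
    rw [← map_redHom (hk := hk), hQ.2.2.2, qBar_eq_conjProd] at h1
    have hd : 0 < l.1 := Nat.pos_of_dvd_of_pos hl (by omega)
    have ho : 0 < orderOf (p : ZMod l.1) := by
      have : NeZero l.1 := ⟨hd.ne'⟩
      rw [← ZMod.coe_unitOfCoprime p (hpn.coprime_dvd_right hl), orderOf_units]
      exact orderOf_pos _
    have h2 := eval_eq_zero_of_dvd_of_eval_eq_zero h1
      ((conjProd_eval_eq_zero_iff _ _ _ _).2 ⟨0, ho, rfl⟩)
    have hprim := isPrimitiveRoot_pow_unit_val hη l.2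
    refine (hprim.pow_eq_one_iff_dvd n).1 ?_
    simpa [sub_eq_zero] using h2
  refine hcop.dvd_of_dvd_mul_left ?_
  have h : (X ^ n - 1) * (X ^ n + 1) = (X ^ (2 * n) - 1 : (ZMod (p ^ k))[X]) := by ring
  rw [h]
  exact hQ.2.2.1

/-- The coprime factors have a monic product dividing `X ^ n + 1`. The degrees agree because, after
reduction, divisibility also holds the other way. -/
theorem prod_qLift [Fintype (LambdaIdx n Ξ)] (hp : p ≠ 2) (hn : 0 < n)
    (hpn : Nat.Coprime p (2 * n))
    (hΞ : ∀ d : ℕ, d ∣ 2 * n → ¬ d ∣ n → IsCosetReps p d (Ξ d))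
    (hη : ∀ d : ℕ, d ∣ 2 * n → ¬ d ∣ n → IsPrimitiveRoot (η d) d) :
    ∏ l : LambdaIdx n Ξ, qLift p n k hk η l.1 = X ^ n + 1 := by
  have hQ : ∀ l : LambdaIdx n Ξ, IsQLift p n k hk η l.1 (qLift p n k hk η l.1) := fun l =>
    Classical.epsilon_spec (exists_isQLift hk hn hpn l.2.1 (hη _ l.2.1 l.2.2.1))
  have : Nontrivial (ZMod (p ^ k)) := (ZMod.castHom (dvd_pow_self p hk) (ZMod p)).domain_nontrivial
  have hdvd : ∏ l : LambdaIdx n Ξ, qLift p n k hk η l.1 ∣ X ^ n + 1 :=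
    Finset.prod_dvd_of_coprime
      (fun l _ l' _ hll => isCoprime_qLift (hk := hk) hn hpn hΞ hη hll)
      (fun l _ => qLift_dvd_X_pow_add_one hn hpn l.2.1 l.2.2.1 (hη _ l.2.1 l.2.2.1))
  have hmon : (∏ l : LambdaIdx n Ξ, qLift p n k hk η l.1).Monic :=
    monic_prod_of_monic _ _ fun l _ => (hQ l).1
  have hmonX : (X ^ n + 1 : (ZMod (p ^ k))[X]).Monic := monic_X_pow_add_C 1 hn.ne'
  refine (eq_of_monic_of_dvd_of_natDegree_le hmon hmonX hdvd ?_).symm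
  have h1 := X_pow_add_one_dvd_prod_qBar hp hn hpn hΞ hη
  have h2 : (∏ l : LambdaIdx n Ξ, qLift p n k hk η l.1).map (redHom p k hk) =
      ∏ l : LambdaIdx n Ξ, qBar p η l.1 := by
    rw [Polynomial.map_prod]
    exact Finset.prod_congr rfl fun l _ => (hQ l).2.2.2
  rw [← h2] at h1
  have h3 := natDegree_le_of_dvd h1 (hmon.map _).ne_zero
  rw [hmon.natDegree_map] at h3
  refine le_trans (le_of_eq ?_) h3
  rw [← C_1, ← C_1, natDegree_X_pow_add_C, natDegree_X_pow_add_C]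

/-- The quotient map onto `G_J`. -/
noncomputable def mkGJ (p : ℕ) [Fact p.Prime] (n k : ℕ) (hk : k ≠ 0)
    (η : ℕ → AlgebraicClosure (ZMod p)) (Ξ : (d : ℕ) → Set (ZMod d)ˣ)
    (J : LambdaIdx n Ξ → Fin (k + 1)) : (ZMod (p ^ k))[X] →+* GJ p n k hk η Ξ J :=
  RingHom.pi fun l => Ideal.Quotient.mk (qIdeal p n k hk η l.1 (J l))

theorem mkGJ_eq_zero_iff {J : LambdaIdx n Ξ → Fin (k + 1)} (s : (ZMod (p ^ k))[X]) :
    mkGJ p n k hk η Ξ J s = 0 ↔ s ∈ ⨅ l : LambdaIdx n Ξ, qIdeal p n k hk η l.1 (J l) := by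
  rw [Submodule.mem_iInf, funext_iff]
  exact forall_congr' fun l => Ideal.Quotient.eq_zero_iff_mem

theorem mkGJ_X_pow (J : LambdaIdx n Ξ → Fin (k + 1)) (i : ℕ) :
    mkGJ p n k hk η Ξ J (X ^ (i - 1)) = omegaJ p n k hk η Ξ J i := rfl

theorem mkGJ_surjective (hn : 0 < n) (hpn : Nat.Coprime p (2 * n))
    (hΞ : ∀ d : ℕ, d ∣ 2 * n → ¬ d ∣ n → IsCosetReps p d (Ξ d))
    (hη : ∀ d : ℕ, d ∣ 2 * n → ¬ d ∣ n → IsPrimitiveRoot (η d) d)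
    (J : LambdaIdx n Ξ → Fin (k + 1)) : Function.Surjective (mkGJ p n k hk η Ξ J) := by
  have := finite_lambdaIdx hn Ξ
  intro x
  obtain ⟨r, hr⟩ := Ideal.pi_quotient_surjective
    (I := fun l : LambdaIdx n Ξ => qIdeal p n k hk η l.1 (J l)) (fun l l' hll => by
      have h := (Ideal.isCoprime_span_singleton_iff _ _).2
        (isCoprime_qLift (k := k) (hk := hk) hn hpn hΞ hη hll)
      refine Ideal.isCoprime_iff_sup_eq.2 (eq_top_iff.2 ?_)
      rw [← Ideal.isCoprime_iff_sup_eq.1 h]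
      exact sup_le_sup (Ideal.span_mono (by simp)) (Ideal.span_mono (by simp))) x
  exact ⟨r, funext hr⟩

theorem mkGJ_X_pow_eq_neg_one (hn : 0 < n) (hpn : Nat.Coprime p (2 * n))
    (hη : ∀ d : ℕ, d ∣ 2 * n → ¬ d ∣ n → IsPrimitiveRoot (η d) d)
    (J : LambdaIdx n Ξ → Fin (k + 1)) : mkGJ p n k hk η Ξ J X ^ n = -1 := by
  rw [← add_eq_zero_iff_eq_neg, ← map_pow, ← map_one (mkGJ p n k hk η Ξ J), ← map_add,
    mkGJ_eq_zero_iff, Submodule.mem_iInf]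
  exact fun l => Ideal.mem_of_dvd _
    (qLift_dvd_X_pow_add_one (hk := hk) hn hpn l.2.1 l.2.2.1 (hη _ l.2.1 l.2.2.1))
    (Ideal.subset_span (by simp))

/-- Multiplication by `x` shifts the powers of `x`, and `x ^ n = -1` accounts for the sign at the
end of the cycle. -/
theorem rotation_eq_mkGJ_X_mul (hn : 0 < n) (hpn : Nat.Coprime p (2 * n))
    (hη : ∀ d : ℕ, d ∣ 2 * n → ¬ d ∣ n → IsPrimitiveRoot (η d) d)
    {J : LambdaIdx n Ξ → Fin (k + 1)} {C : CayleyMap (GJ p n k hk η Ξ J)}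
    (hC : C.HasSignedCycle n (omegaJ p n k hk η Ξ J)) (x : C.Ω) :
    (C.ρ x : GJ p n k hk η Ξ J) = mkGJ p n k hk η Ξ J X * x := by
  obtain ⟨x, hx⟩ := x
  obtain ⟨i, h1, h2, hxi⟩ := (Set.ext_iff.1 hC.1 x).1 hx
  have hmul : ∀ i, 1 ≤ i → mkGJ p n k hk η Ξ J X * omegaJ p n k hk η Ξ J i =
      mkGJ p n k hk η Ξ J X ^ i := by
    intro i hi
    rw [← mkGJ_X_pow, map_pow, mul_pow_sub_one (by omega)]
  have hω : ∀ i, omegaJ p n k hk η Ξ J (i + 1) = mkGJ p n k hk η Ξ J X ^ i := fun i => by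
    rw [← mkGJ_X_pow, map_pow, Nat.add_sub_cancel]
  have hω1 : omegaJ p n k hk η Ξ J 1 = 1 := by rw [hω 0, pow_zero]
  rcases h2.lt_or_eq with h2 | rfl
  · obtain ⟨⟨ha, ha'⟩, ⟨hb, hb'⟩⟩ := hC.2.1 i h1 h2
    rcases hxi with rfl | rfl
    · exact ha'.trans ((hω i).trans (hmul i h1).symm)
    · refine hb'.trans ?_
      rw [hω i, ← hmul i h1]
      exact (mul_neg (mkGJ p n k hk η Ξ J X) (omegaJ p n k hk η Ξ J i)).symm
  · obtain ⟨⟨ha, ha'⟩, ⟨hb, hb'⟩⟩ := hC.2.2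
    have hneg := mkGJ_X_pow_eq_neg_one (hk := hk) hn hpn hη J
    rcases hxi with rfl | rfl
    · refine ha'.trans ?_
      rw [hmul i h1, hneg, hω1]
    · refine hb'.trans ?_
      refine Eq.trans ?_ (mul_neg (mkGJ p i k hk η Ξ J X) (omegaJ p i k hk η Ξ J i)).symm
      rw [hmul i h1, hneg, hω1]
      exact (neg_neg _).symm

/-- An isomorphism onto a Cayley map on `G_J` determines the annihilator of `w 1`. -/
theorem annVec_eq_iInf_qIdeal (hn : 0 < n) (hpn : Nat.Coprime p (2 * n))
    (hη : ∀ d : ℕ, d ∣ 2 * n → ¬ d ∣ n → IsPrimitiveRoot (η d) d)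
    {G : Type*} [AddCommGroup G] [Finite G] [Module (ZMod (p ^ k)) G] {M : CayleyMap G}
    {w : ℕ → G} (hM : M.HasSignedCycle n w) {α : Module.End (ZMod (p ^ k)) G}
    (hα : ∀ x : M.Ω, α x = M.ρ x)
    {J : LambdaIdx n Ξ → Fin (k + 1)} {C : CayleyMap (GJ p n k hk η Ξ J)}
    (hC : C.HasSignedCycle n (omegaJ p n k hk η Ξ J)) (hMC : M.Isomorphic C) :
    annVec α (w 1) = ⨅ l : LambdaIdx n Ξ, qIdeal p n k hk η l.1 (J l) := by
  obtain ⟨φ, hφ⟩ := hMC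
  obtain ⟨g, -, hg⟩ := hφ.exists_addEquiv hM.iterate_eq_neg hC.iterate_eq_neg
  have hgα : ∀ a, g (α a) = mkGJ p n k hk η Ξ J X * g a := by
    intro a
    have ha : a ∈ AddSubgroup.closure M.Ω := by rw [M.closure_eq_top]; trivial
    induction ha using AddSubgroup.closure_induction with
    | mem x hx =>
      obtain ⟨h, hr⟩ := hg ⟨x, hx⟩
      rw [hα ⟨x, hx⟩, hr, rotation_eq_mkGJ_X_mul hn hpn hη hC]
    | zero => simp
    | add x y _ _ h1 h2 => rw [map_add, map_add, map_add, h1, h2, mul_add]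
    | neg x _ h1 => rw [map_neg, map_neg, map_neg, h1]; exact (mul_neg (mkGJ p n k hk η Ξ J X) (g x)).symm
  have hgs : ∀ s, g (evalVec α (w 1) s) = mkGJ p n k hk η Ξ J s * g (w 1) := by
    intro s
    induction s using Polynomial.induction_on with
    | C a =>
      obtain ⟨b, rfl⟩ := ZMod.natCast_zmod_surjective a
      rw [evalVec_C, Nat.cast_smul_eq_nsmul, map_nsmul, nsmul_eq_mul, map_natCast, map_natCast]
    | add s t hs ht => rw [map_add, map_add, map_add, hs, ht, add_mul]
    | monomial m a h =>
      have e : Polynomial.C a * X ^ (m + 1) = X * (Polynomial.C a * X ^ m) := by ring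
      rw [e, evalVec_X_mul, hgα, h, map_mul _ X, mul_assoc]
  have hX : IsUnit (mkGJ p n k hk η Ξ J X) := by
    rw [← isUnit_pow_iff hn.ne', mkGJ_X_pow_eq_neg_one hn hpn hη]
    exact IsUnit.neg (α := GJ p n k hk η Ξ J) isUnit_one
  -- The image of `w 1` need not be `1`, but it is some `± x ^ (i - 1)`. A unit has the same
  -- annihilator as `1`.
  have hunit : IsUnit (g (w 1)) := by
    obtain ⟨h, -⟩ := hg ⟨w 1, hM.mem le_rfl hn⟩
    rw [hC.1] at h
    obtain ⟨i, h1, h2, h | h⟩ := h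
    · rw [h, ← mkGJ_X_pow, map_pow]
      exact hX.pow _
    · rw [h, ← mkGJ_X_pow, map_pow]
      exact (hX.pow _).neg
  ext s
  rw [mem_annVec, ← mkGJ_eq_zero_iff, ← g.map_eq_zero_iff, hgs, hunit.mul_left_eq_zero]

end Family

/-! ### The classification. -/

theorem mainTheorem4 (p n k : ℕ) [Fact p.Prime] (hp : p ≠ 2) (hpn : Nat.Coprime n p) (hk : k ≠ 0)
    (Ξ : (d : ℕ) → Set (ZMod d)ˣ)
    (hΞ : ∀ d : ℕ, d ∣ 2 * n → ¬ d ∣ n → IsCosetReps p d (Ξ d))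
    (η : ℕ → AlgebraicClosure (ZMod p))
    (hη : ∀ d : ℕ, d ∣ 2 * n → ¬ d ∣ n → IsPrimitiveRoot (η d) d)
    {G : Type*} [AddCommGroup G] [Finite G] (hG : AddMonoid.exponent G = p ^ k)
    (M : CayleyMap G) (hM : M.IsRBCM) (hI : M.IsTypeI n) :
    ∃! J : LambdaIdx n Ξ → Fin (k + 1),
      Fin.last k ∈ Set.range J ∧
      ∃ C : CayleyMap (GJ p n k hk η Ξ J),
        C.HasSignedCycle n (omegaJ p n k hk η Ξ J) ∧ M.Isomorphic C := by
  have hprime : p.Prime := Fact.out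
  have hn : 0 < n := Nat.pos_of_ne_zero fun h => by
    rw [h, Nat.coprime_zero_left] at hpn
    exact hprime.one_lt.ne' hpn
  have hpn2 : Nat.Coprime p (2 * n) :=
    Nat.Coprime.mul_right ((Nat.coprime_primes hprime Nat.prime_two).2 hp) hpn.symm
  have := finite_lambdaIdx hn Ξ
  have := Fintype.ofFinite (LambdaIdx n Ξ)
  obtain ⟨-, w, hw⟩ := hI
  obtain ⟨α', hα'⟩ := hM.1.exists_addMonoidHom hw.iterate_eq_neg
  have : Module (ZMod (p ^ k)) G := AddCommGroup.zmodModule fun x => by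
    rw [← hG]
    exact AddMonoid.exponent_nsmul_eq_zero x
  obtain ⟨α, hα⟩ : ∃ α : Module.End (ZMod (p ^ k)) G, ∀ x : M.Ω, α x = M.ρ x :=
    ⟨α'.toZModLinearMap (p ^ k), hα'⟩
  have hP : (p : (ZMod (p ^ k))[X]) ^ k = 0 := by
    rw [← map_natCast C, ← C_pow, natCast_prime_pow_eq_zero, C_0]
  have hcop := isCoprime_qLift (k := k) (hk := hk) hn hpn2 hΞ hη
  have hirr : ∀ l : LambdaIdx n Ξ, _ := fun l =>
    irreducible_map_qLift hk hn hpn2 l.2.1 (hη _ l.2.1 l.2.2.1)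
  have hmax : ∀ l : LambdaIdx n Ξ,
      (Ideal.span {qLift p n k hk η l.1, (p : (ZMod (p ^ k))[X])}).IsMaximal := fun l => by
    rw [← map_natCast C]
    exact isMaximal_span_pair (castHom_pow_surjective hk) (ker_castHom_pow hk) (hirr l)
  have hpow : ∀ l : LambdaIdx n Ξ, ∀ u < k,
      (p : (ZMod (p ^ k))[X]) ^ u ∉ Ideal.span {qLift p n k hk η l.1} := fun l u hu => by
    have hQ : IsQLift p n k hk η l.1 (qLift p n k hk η l.1) :=
      Classical.epsilon_spec (exists_isQLift hk hn hpn2 l.2.1 (hη _ l.2.1 l.2.2.1))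
    exact pow_notMem_span_of_monic hQ.1
      ((hirr l).natDegree_pos.trans_le natDegree_map_le) hu
  obtain ⟨J, hJ⟩ := Ideal.exists_eq_iInf_span_pair_pow hP hmax hcop
    (I := annVec α (w 1)) (by rw [prod_qLift hp hn hpn2 hΞ hη]; exact hw.X_pow_add_one_mem hn hα)
  refine ⟨J, ⟨?_, ?_⟩, ?_⟩
  -- If every `J l` were below `k`, then `p ^ (k - 1)` would kill the generator `w 1`, hence all of
  -- `G`.
  · by_contra hlast
    have hmem : (p : (ZMod (p ^ k))[X]) ^ (k - 1) ∈ annVec α (w 1) := by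
      rw [hJ, Submodule.mem_iInf]
      intro l
      have hl : (J l : ℕ) ≤ k - 1 := by
        have h1 : J l ≠ Fin.last k := fun h => hlast ⟨l, h⟩
        have h2 := Fin.val_lt_last h1
        omega
      exact Ideal.mem_of_dvd _ (pow_dvd_pow _ hl) (Ideal.subset_span (by simp))
    have hexp : AddMonoid.exponent G ∣ p ^ (k - 1) := by
      refine AddMonoid.exponent_dvd_of_forall_nsmul_eq_zero fun x => ?_
      obtain ⟨s, rfl⟩ := hw.evalVec_surjective hα x
      rw [← map_nsmul, nsmul_eq_mul, Nat.cast_pow]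
      exact mem_annVec.1 (Ideal.mul_mem_right _ _ hmem)
    rw [hG, Nat.pow_dvd_pow_iff_le_right hprime.one_lt] at hexp
    omega
  -- Both `G` and `G_J` are quotients of `ℤ/p^k[x]` by the same ideal. The resulting isomorphism
  -- sends `w i` to the image of `x ^ (i - 1)`, so transporting `M` gives the required map.
  · obtain ⟨e, he⟩ := AddMonoidHom.exists_addEquiv_of_ker_eq (hw.evalVec_surjective hα)
      (g := (mkGJ p n k hk η Ξ J : (ZMod (p ^ k))[X] →+ GJ p n k hk η Ξ J))
      (mkGJ_surjective hn hpn2 hΞ hη J) (by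
        ext s
        rw [AddMonoidHom.mem_ker, AddMonoidHom.mem_ker, ← mem_annVec, hJ]
        exact (mkGJ_eq_zero_iff s).symm)
    refine ⟨M.transport e, (hw.transport e).congr hn fun i h1 h2 => ?_, M.isomorphic_transport e⟩
    rw [← mkGJ_X_pow]
    refine Eq.trans ?_ (he (X ^ (i - 1)))
    rw [hw.evalVec_X_pow hα _ (by omega), Nat.sub_add_cancel h1]
  · rintro J' ⟨-, C, hC, hMC⟩
    have h := annVec_eq_iInf_qIdeal hn hpn2 hη hw hα hC hMC
    rw [hJ] at h
    exact Ideal.iInf_span_pair_pow_injective hP hpow hcop h.symm
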